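/- Let $\mu:[0,1]^2\to[0,\infty)$ be continuous with zero set $S_0=\mu^{-1}(0)$. For each $m\ge 1$ put $n=m^2$, $x_{kl}=(k/m,l/m)$ for $1\le k,l\le m$, and observe $$Y_{kl}=\mu(x_{kl})+\epsilon_{kl},\qquad 1\le k,l\le m,$$ where the errors $\epsilon_{kl}$ are independent and identically distributed with mean $0$ and finite variance, their common law not depending on $m$. Let $K(x_1,x_2)=K_0(x_1)K_0(x_2)$ be Lipschitz continuous, where $K_0$ is a symmetric probability density on $\mathbb R$ with $K_0(t)=0$ for $|t|\ge L_0$, for some $L_0>0$. Let $h_n=h_0n^{-\beta}$ with $h_0>0$ and $0<\beta<1/2$, and put $$\hat\mu(x)=\frac1{nh_n^2}\sum_{k,l=1}^m Y_{kl}\,K\Big(\frac{x-x_{kl}}{h_n}\Big),\qquad \mathcal I_n=[L_0h_n,\,1-L_0h_n]^2 .$$ Let $\mathcal S$ be the class of closed convex subsets of $[0,1]^2$, $\lambda$ Lebesgue measure, $\Phi$ the standard normal distribution function and $\gamma\in(1/2,1)$. For $S\in\mathcal S$ define $$\mathbb M_n(S)=\frac1n\sum_{k,l:\,x_{kl}\in\mathcal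 I_n}\Big\{\Phi\big(\sqrt{nh_n^2}\,\hat\mu(x_{kl})\big)-\gamma\Big\}1_S(x_{kl}),$$ $$M(S)=\big(\tfrac12-\gamma\big)\lambda(S_0\cap S)+(1-\gamma)\lambda(S_0^c\cap S).$$ **Theorem.** Assume that $S_0$ is a closed convex set and the unique minimizer of $M$ over $\mathcal S$. Then, as $m\to\infty$ (so $n=m^2\to\infty$), $\sup_{S\in\mathcal S}|\mathbb M_n(S)-M(S)|\to0$ in (outer) probability. Moreover, $\mathbb M_n$ always attains its minimum over $\mathcal S$, and for every choice of minimizers $\hat S_n\in\operatorname{argmin}_{S\in\mathcal S}\mathbb M_n(S)$ one has $\lambda(\hat S_n\triangle S_0)\to0$ in (outer) probability. -/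

import Mathlib

open MeasureTheory ProbabilityTheory Filter Set
open scoped Topology symmDiff

namespace BaselineRegion

/-- The design domain `[0,1]²`. The plane is `ℝ × ℝ`, whose `volume` is Lebesgue measure. -/
def unitSquare : Set (ℝ × ℝ) := Icc 0 1 ×ˢ Icc 0 1

/-- The class of closed convex subsets of `[0,1]²`. -/
def closedConvexSets : Set (Set (ℝ × ℝ)) :=
  {S | S ⊆ unitSquare ∧ IsClosed S ∧ Convex ℝ S}

/-- `S` minimizes the criterion `M` over the closed convex subsets of `[0,1]²`. -/
def IsMinimizer (M : Set (ℝ × ℝ) → ℝ) (S : Set (ℝ × ℝ)) : Prop :=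
  S ∈ closedConvexSets ∧ ∀ T ∈ closedConvexSets, M S ≤ M T

/-- The baseline region `S₀`: the zero set of `μ` in `[0,1]²`. -/
def baselineSet (μ : ℝ × ℝ → ℝ) : Set (ℝ × ℝ) := {x | x ∈ unitSquare ∧ μ x = 0}

/-- The limiting criterion `M(S) = (1/2 - γ) λ(S₀ ∩ S) + (1 - γ) λ(S₀ᶜ ∩ S)`. -/
noncomputable def limitCriterion (γ : ℝ) (S₀ S : Set (ℝ × ℝ)) : ℝ :=
  (1 / 2 - γ) * volume.real (S₀ ∩ S) + (1 - γ) * volume.real (S₀ᶜ ∩ S)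

/-- Assumptions on the one-dimensional kernel `K₀`: a symmetric probability density vanishing
outside `(-L₀, L₀)`, whose two-fold product is Lipschitz continuous. -/
structure IsSmoothingKernel (K₀ : ℝ → ℝ) (L₀ : ℝ) : Prop where
  nonneg : ∀ t, 0 ≤ K₀ t
  integrable : Integrable K₀
  integral_eq_one : ∫ t, K₀ t = 1
  symm : ∀ t, K₀ (-t) = K₀ t
  radius_pos : 0 < L₀
  eq_zero : ∀ t, L₀ ≤ |t| → K₀ t = 0
  lipschitz : ∃ C, LipschitzWith C (fun x : ℝ × ℝ => K₀ x.1 * K₀ x.2)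

/-- The product kernel `K(x₁, x₂) = K₀(x₁) K₀(x₂)`. -/
def productKernel (K₀ : ℝ → ℝ) (x : ℝ × ℝ) : ℝ := K₀ x.1 * K₀ x.2

/-- The indices `(k, l)`, `1 ≤ k, l ≤ m`, of the `n = m²` design points. -/
def gridIndex (m : ℕ) : Finset (ℕ × ℕ) := Finset.Icc 1 m ×ˢ Finset.Icc 1 m

/-- The design point `x_{kl} = (k/m, l/m)`. -/
noncomputable def designPoint (m : ℕ) (i : ℕ × ℕ) : ℝ × ℝ := ((i.1 : ℝ) / m, (i.2 : ℝ) / m)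

/-- The bandwidth `h_n = h₀ n^{-β}` with `n = m²`. -/
noncomputable def bandwidth (h₀ β : ℝ) (m : ℕ) : ℝ := h₀ * ((m : ℝ) ^ 2) ^ (-β)

/-- The response `Y_{kl} = μ(x_{kl}) + ε_{kl}`, given the values `e` of the errors. -/
noncomputable def response (μ : ℝ × ℝ → ℝ) (m : ℕ) (e : ℕ × ℕ → ℝ) (i : ℕ × ℕ) : ℝ :=
  μ (designPoint m i) + e i

/-- The kernel estimate `μ̂(x) = (n h²)⁻¹ ∑_{k,l} y_{kl} K((x - x_{kl}) / h)` from the data `y`,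
with `n = m²`. -/
noncomputable def kernelEstimate (K₀ : ℝ → ℝ) (h : ℝ) (m : ℕ) (y : ℕ × ℕ → ℝ) (x : ℝ × ℝ) : ℝ :=
  1 / ((m : ℝ) ^ 2 * h ^ 2) *
    ∑ i ∈ gridIndex m, y i * productKernel K₀ (h⁻¹ • (x - designPoint m i))

/-- The region `[L₀ h, 1 - L₀ h]²` on which the kernel estimate is used. -/
def innerSquare (L₀ h : ℝ) : Set (ℝ × ℝ) :=
  Icc (L₀ * h) (1 - L₀ * h) ×ˢ Icc (L₀ * h) (1 - L₀ * h)

/-- The standard normal distribution function. -/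
noncomputable def stdNormalCDF (t : ℝ) : ℝ := cdf (gaussianReal 0 1) t

open Classical in
/-- The empirical criterion
`𝕄ₙ(S) = n⁻¹ ∑_{k,l : x_{kl} ∈ Iₙ} {Φ(√(n h²) μ̂(x_{kl})) - γ} 1_S(x_{kl})`
computed from the data `y`, with `n = m²` and `Iₙ = [L₀ h, 1 - L₀ h]²`. -/
noncomputable def empiricalCriterion (K₀ : ℝ → ℝ) (L₀ h γ : ℝ) (m : ℕ) (y : ℕ × ℕ → ℝ)
    (S : Set (ℝ × ℝ)) : ℝ :=
  1 / (m : ℝ) ^ 2 *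
    ∑ i ∈ gridIndex m with designPoint m i ∈ innerSquare L₀ h,
      (stdNormalCDF (√((m : ℝ) ^ 2 * h ^ 2) * kernelEstimate K₀ h m y (designPoint m i)) - γ) *
        S.indicator (fun _ => (1 : ℝ)) (designPoint m i)

end BaselineRegion

/-! Consistency of the minimizers rests on separation and uniform convergence. Separation holds
since M(S) - M(S₀) = (γ - 1/2) λ(S₀ \ S) + (1 - γ) λ(S \ S₀), which is at least a positive multiple
of λ(S ∆ S₀) (`mul_volume_symmDiff_le_limitCriterion_sub`). A minimizer of the empirical criterion
therefore cannot stay away from S₀ once the two criteria are uniformly close.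

For a fixed convex set the criterion converges by a mean and variance argument. The standardized
estimate at a design point is a signal plus a weighted sum of errors, with weights O(1/(mh)) and
bounded sum of squares. Near a point with μ > 0 the signal grows like mh and the expected score
tends to 1. Inside S₀ the signal vanishes, and the expected score must tend to 1/2. No central limit
theorem is needed for this: as Φ(-x) = 1 - Φ(x), it is enough that reflecting the noise hardly
changes the mean of Φ. Lindeberg's swapping of each summand with its negative shows it, because the
even Taylor terms cancel and the linear one has mean zero. Boundaries of convex sets are null, so
dominated convergence gives the limit of the means. Scores at points with disjoint windows are
independent, so the variance is O((h + 1/m)²).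

Uniformity comes from a partition into q² cells. A closed convex set cuts only O(q) of them
(`card_boundaryCells_le`), and each contributes O(1/q²), hence O(1/q) in all. The remaining cells
lie inside or outside the set, and a union bound over finitely many fixed cells handles them. -/

namespace BaselineRegion

/-! ### The standard normal distribution function -/

/-- The standard normal density. -/
noncomputable def stdNormalPDF (x : ℝ) : ℝ := gaussianPDFReal 0 1 x

lemma stdNormalPDF_eq (x : ℝ) : stdNormalPDF x = (√(2 * Real.pi))⁻¹ * Real.exp (-x ^ 2 / 2) := by
  simp [stdNormalPDF, gaussianPDFReal]

lemma continuous_stdNormalPDF : Continuous stdNormalPDF := by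
  simp only [funext stdNormalPDF_eq]
  fun_prop

lemma stdNormalCDF_eq_integral (x : ℝ) :
    stdNormalCDF x = ∫ t in Iic x, stdNormalPDF t := by
  rw [stdNormalCDF, cdf_eq_real, measureReal_def,
    gaussianReal_apply_eq_integral 0 one_ne_zero, ENNReal.toReal_ofReal]
  · rfl
  · exact integral_nonneg fun t => gaussianPDFReal_nonneg _ _ _

lemma hasDerivAt_stdNormalCDF (x : ℝ) : HasDerivAt stdNormalCDF (stdNormalPDF x) x := by
  have hint : Integrable stdNormalPDF := integrable_gaussianPDFReal 0 1
  have h : stdNormalCDF = fun y => stdNormalCDF 0 + ∫ t in (0 : ℝ)..y, stdNormalPDF t := by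
    funext y
    have := intervalIntegral.integral_Iic_sub_Iic (a := 0) (b := y)
      hint.integrableOn hint.integrableOn
    rw [stdNormalCDF_eq_integral, stdNormalCDF_eq_integral, ← this]
    ring
  rw [h]
  exact (continuous_stdNormalPDF.integral_hasStrictDerivAt 0 x).hasDerivAt.const_add _

lemma hasDerivAt_stdNormalPDF (x : ℝ) :
    HasDerivAt stdNormalPDF (-x * stdNormalPDF x) x := by
  have h1 : HasDerivAt (fun x : ℝ => -x ^ 2 / 2) (-x) x := by
    have := ((hasDerivAt_pow 2 x).neg).div_const 2
    refine HasDerivAt.congr_deriv this ?_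
    norm_num
    ring
  have h2 := (h1.exp).const_mul (√(2 * Real.pi))⁻¹
  simp only [funext stdNormalPDF_eq]
  exact h2.congr_deriv (by ring)

lemma hasDerivAt_neg_mul_stdNormalPDF (x : ℝ) :
    HasDerivAt (fun x => -x * stdNormalPDF x) ((x ^ 2 - 1) * stdNormalPDF x) x := by
  have := ((hasDerivAt_id x).neg).mul (hasDerivAt_stdNormalPDF x)
  exact HasDerivAt.congr_deriv this (by simp only [Pi.neg_apply, id]; ring)

lemma stdNormalPDF_nonneg (x : ℝ) : 0 ≤ stdNormalPDF x := gaussianPDFReal_nonneg _ _ _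

/-- Follows from 1 + y ≤ exp y and √(2π) ≥ 2. This single estimate bounds both the first and the
second derivative of the density by 1. -/
lemma sq_div_two_add_one_mul_stdNormalPDF_le (x : ℝ) : (x ^ 2 / 2 + 1) * stdNormalPDF x ≤ 1 / 2 := by
  rw [stdNormalPDF_eq]
  have h1 : x ^ 2 / 2 + 1 ≤ Real.exp (x ^ 2 / 2) := Real.add_one_le_exp _
  have h2 : (2 : ℝ) ≤ √(2 * Real.pi) := by
    apply Real.le_sqrt_of_sq_le
    nlinarith [Real.pi_gt_three]
  have h3 : (√(2 * Real.pi))⁻¹ ≤ 1 / 2 := by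
    rw [one_div]
    exact inv_anti₀ (by norm_num) h2
  have h4 : Real.exp (x ^ 2 / 2) * Real.exp (-x ^ 2 / 2) = 1 := by
    rw [← Real.exp_add]
    simp [neg_div]
  calc (x ^ 2 / 2 + 1) * ((√(2 * Real.pi))⁻¹ * Real.exp (-x ^ 2 / 2))
      ≤ Real.exp (x ^ 2 / 2) * ((√(2 * Real.pi))⁻¹ * Real.exp (-x ^ 2 / 2)) := by gcongr
    _ = (√(2 * Real.pi))⁻¹ := by rw [mul_left_comm, h4, mul_one]
    _ ≤ 1 / 2 := h3

lemma abs_neg_mul_stdNormalPDF_le (x : ℝ) : |(-x) * stdNormalPDF x| ≤ 1 := by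
  have h := sq_div_two_add_one_mul_stdNormalPDF_le x
  have h0 := stdNormalPDF_nonneg x
  rw [abs_mul, abs_of_nonneg h0, abs_neg]
  have : |x| ≤ x ^ 2 / 2 + 1 := by
    rw [← sq_abs]
    nlinarith [sq_nonneg (|x| - 1)]
  nlinarith

lemma abs_sq_sub_one_mul_stdNormalPDF_le (x : ℝ) : |(x ^ 2 - 1) * stdNormalPDF x| ≤ 1 := by
  have h := sq_div_two_add_one_mul_stdNormalPDF_le x
  have h0 := stdNormalPDF_nonneg x
  rw [abs_mul, abs_of_nonneg h0]
  have : |x ^ 2 - 1| ≤ 2 * (x ^ 2 / 2 + 1) := by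
    rw [abs_le]
    constructor <;> nlinarith [sq_nonneg x]
  nlinarith

lemma stdNormalCDF_nonneg (x : ℝ) : 0 ≤ stdNormalCDF x := cdf_nonneg _ x

lemma stdNormalCDF_le_one (x : ℝ) : stdNormalCDF x ≤ 1 := cdf_le_one _ x

lemma monotone_stdNormalCDF : Monotone stdNormalCDF := monotone_cdf _

lemma tendsto_stdNormalCDF_atTop : Tendsto stdNormalCDF atTop (𝓝 1) := tendsto_cdf_atTop _

lemma continuous_stdNormalCDF : Continuous stdNormalCDF :=
  continuous_iff_continuousAt.2 fun x => (hasDerivAt_stdNormalCDF x).continuousAt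

/-- The density is even, so Φ(y) + Φ(-y) has derivative zero; its constant value is read off as y →
∞. -/
lemma stdNormalCDF_neg (x : ℝ) : stdNormalCDF (-x) = 1 - stdNormalCDF x := by
  have hd : ∀ y, HasDerivAt (fun y => stdNormalCDF y + stdNormalCDF (-y)) 0 y := by
    intro y
    have h1 := (hasDerivAt_stdNormalCDF y).add
      ((hasDerivAt_stdNormalCDF (-y)).comp y (hasDerivAt_id y).neg)
    exact HasDerivAt.congr_deriv h1 (by simp [stdNormalPDF_eq])
  have hc : ∀ y, stdNormalCDF y + stdNormalCDF (-y) = stdNormalCDF x + stdNormalCDF (-x) :=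
    fun y => is_const_of_deriv_eq_zero (fun z => (hd z).differentiableAt) (fun z => (hd z).deriv) y x
  have h1 : Tendsto (fun y => stdNormalCDF y + stdNormalCDF (-y)) atTop (𝓝 (1 + 0)) :=
    tendsto_stdNormalCDF_atTop.add ((tendsto_cdf_atBot _).comp tendsto_neg_atTop_atBot)
  have h2 := tendsto_nhds_unique (h1.congr hc) tendsto_const_nhds
  linarith

/-- A third order symmetric Taylor estimate for the normal distribution function. -/
lemma abs_stdNormalCDF_add_sub_le (c u : ℝ) :
    |stdNormalCDF (c + u) - stdNormalCDF (c - u) - 2 * stdNormalPDF c * u| ≤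
      2 * (u ^ 2 * min 1 |u|) := by
  wlog hu : 0 ≤ u generalizing u
  · have := this (-u) (by linarith)
    rw [abs_neg, neg_sq, ← abs_neg] at this
    convert this using 2
    ring_nf
  rw [abs_of_nonneg hu]
  -- Both sides of the minimum are needed: boundedness of φ' gives the 1, its Lipschitz bound gives
  -- the s. The truncation is what lets a finite second moment suffice later. Two applications of
  -- the mean value inequality then lift this bound to Φ.
  have hk : ∀ s, 0 ≤ s → |-(c + s) * stdNormalPDF (c + s) - -(c - s) * stdNormalPDF (c - s)| ≤
      2 * min 1 s := by
    intro s hs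
    rw [mul_min_of_nonneg _ _ zero_le_two]
    refine le_min ?_ ?_
    · have h1 := abs_neg_mul_stdNormalPDF_le (c + s)
      have h2 := abs_neg_mul_stdNormalPDF_le (c - s)
      have h3 := norm_sub_le (-(c + s) * stdNormalPDF (c + s)) (-(c - s) * stdNormalPDF (c - s))
      simp only [Real.norm_eq_abs] at h3
      linarith
    · have := convex_univ.norm_image_sub_le_of_norm_hasDerivWithin_le (s := univ) (C := 1)
        (f := fun x => -x * stdNormalPDF x)
        (fun x _ => (hasDerivAt_neg_mul_stdNormalPDF x).hasDerivWithinAt)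
        (fun x _ => abs_sq_sub_one_mul_stdNormalPDF_le x) (mem_univ (c - s)) (mem_univ (c + s))
      simp only [Real.norm_eq_abs] at this
      refine this.trans ?_
      rw [show c + s - (c - s) = 2 * s by ring, abs_of_nonneg (by positivity)]
      linarith
  have hE : ∀ t, 0 ≤ t → |stdNormalPDF (c + t) + stdNormalPDF (c - t) - 2 * stdNormalPDF c| ≤
      2 * (t * min 1 t) := by
    intro t ht
    have := (convex_Icc (0 : ℝ) t).norm_image_sub_le_of_norm_hasDerivWithin_le
      (C := 2 * min 1 t)
      (f := fun s => stdNormalPDF (c + s) + stdNormalPDF (c - s))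
      (f' := fun s => -(c + s) * stdNormalPDF (c + s) - -(c - s) * stdNormalPDF (c - s))
      (fun x _ => by
        have h1 := (hasDerivAt_stdNormalPDF (c + x)).comp_const_add c x
        have h2 := (hasDerivAt_stdNormalPDF (c - x)).comp_const_sub c x
        exact (by simpa [sub_eq_add_neg] using! h1.add h2 : HasDerivAt _ _ _).hasDerivWithinAt)
      (fun x hx => (hk x hx.1).trans (by gcongr; exact hx.2))
      (left_mem_Icc.2 ht) (right_mem_Icc.2 ht)
    simp only [Real.norm_eq_abs, sub_zero, add_zero, abs_of_nonneg ht] at this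
    rw [show 2 * stdNormalPDF c = stdNormalPDF c + stdNormalPDF c by ring]
    linarith
  have := (convex_Icc (0 : ℝ) u).norm_image_sub_le_of_norm_hasDerivWithin_le
    (C := 2 * (u * min 1 u))
    (f := fun s => stdNormalCDF (c + s) - stdNormalCDF (c - s) - 2 * stdNormalPDF c * s)
    (f' := fun s => stdNormalPDF (c + s) + stdNormalPDF (c - s) - 2 * stdNormalPDF c)
    (fun x _ => by
      have h1 := (hasDerivAt_stdNormalCDF (c + x)).comp_const_add c x
      have h2 := (hasDerivAt_stdNormalCDF (c - x)).comp_const_sub c x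
      have h3 := (hasDerivAt_id x).const_mul (2 * stdNormalPDF c)
      exact (by simpa [sub_eq_add_neg] using! (h1.sub h2).sub h3 :
        HasDerivAt _ _ _).hasDerivWithinAt)
    (fun x hx => (hE x hx.1).trans (by
      have := hx.1
      have := hx.2
      gcongr))
    (left_mem_Icc.2 hu) (right_mem_Icc.2 hu)
  simp only [Real.norm_eq_abs, sub_zero, add_zero, abs_of_nonneg hu, mul_zero, sub_self] at this
  calc _ ≤ _ := this
    _ = _ := by ring

/-! ### Normal scores of weighted sums of independent errors -/

lemma integrable_stdNormalCDF_comp {α : Type*} [MeasurableSpace α] {P : Measure α}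
    [IsFiniteMeasure P] {f : α → ℝ} (hf : AEMeasurable f P) :
    Integrable (fun ω => stdNormalCDF (f ω)) P := by
  refine Integrable.of_bound
    (continuous_stdNormalCDF.measurable.comp_aemeasurable hf).aestronglyMeasurable 1 ?_
  refine ae_of_all _ fun ω => ?_
  rw [Real.norm_eq_abs, abs_of_nonneg (stdNormalCDF_nonneg _)]
  exact stdNormalCDF_le_one _

/-- If reflecting each of two laws changes the means of all shifts of the normal distribution
function by at most `A` and `B`, then reflecting their convolution changes them by at most
`A + B`. -/
lemma abs_integral_stdNormalCDF_conv_le {ρ ρ' : Measure ℝ} [IsProbabilityMeasure ρ]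
    [IsProbabilityMeasure ρ'] {A B : ℝ}
    (hA : ∀ c, |∫ x, stdNormalCDF (c + x) ∂ρ - ∫ x, stdNormalCDF (c - x) ∂ρ| ≤ A)
    (hB : ∀ c, |∫ x, stdNormalCDF (c + x) ∂ρ' - ∫ x, stdNormalCDF (c - x) ∂ρ'| ≤ B) (c : ℝ) :
    |∫ x, stdNormalCDF (c + x) ∂(ρ.conv ρ') - ∫ x, stdNormalCDF (c - x) ∂(ρ.conv ρ')| ≤
      A + B := by
  have key : ∀ {f : ℝ → ℝ → ℝ} {g : ℝ → ℝ → ℝ} {σ σ' : Measure ℝ} [IsProbabilityMeasure σ]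
      [IsProbabilityMeasure σ'] {D : ℝ}, (Measurable f.uncurry) → (Measurable g.uncurry) →
      (∀ x, |∫ y, stdNormalCDF (f x y) ∂σ' - ∫ y, stdNormalCDF (g x y) ∂σ'| ≤ D) →
      |∫ x, ∫ y, stdNormalCDF (f x y) ∂σ' ∂σ - ∫ x, ∫ y, stdNormalCDF (g x y) ∂σ' ∂σ| ≤ D := by
    intro f g σ σ' _ _ D hf hg h
    have hfi := (integrable_stdNormalCDF_comp (P := σ.prod σ') hf.aemeasurable).integral_prod_left
    have hgi := (integrable_stdNormalCDF_comp (P := σ.prod σ') hg.aemeasurable).integral_prod_left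
    simp only [Function.uncurry] at hfi hgi
    rw [← integral_sub hfi hgi]
    have := norm_integral_le_of_norm_le_const (μ := σ) (C := D)
      (f := fun x => ∫ y, stdNormalCDF (f x y) ∂σ' - ∫ y, stdNormalCDF (g x y) ∂σ')
      (ae_of_all _ h)
    simpa using this
  rw [integral_conv (integrable_stdNormalCDF_comp (by fun_prop)),
    integral_conv (integrable_stdNormalCDF_comp (by fun_prop))]
  -- The two components are reflected in turn: first y with x frozen into the shift, then, after
  -- exchanging the integrals, x with y frozen. This is why the hypotheses are uniform in c.
  have h1 : |∫ x, ∫ y, stdNormalCDF (c + (x + y)) ∂ρ' ∂ρ -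
      ∫ x, ∫ y, stdNormalCDF (c + (x - y)) ∂ρ' ∂ρ| ≤ B := by
    refine key (by fun_prop) (by fun_prop) fun x => ?_
    simpa only [add_assoc, add_sub_assoc] using hB (c + x)
  have h2 : |∫ y, ∫ x, stdNormalCDF (c + (x - y)) ∂ρ ∂ρ' -
      ∫ y, ∫ x, stdNormalCDF (c - (x + y)) ∂ρ ∂ρ'| ≤ A := by
    refine key (by fun_prop) (by fun_prop) fun y => ?_
    convert hA (c - y) using 6
    · ring
    · ring
  rw [integral_integral_swap
      (f := fun y x => stdNormalCDF (c + (x - y))) (integrable_stdNormalCDF_comp (by fun_prop)),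
    integral_integral_swap
      (f := fun y x => stdNormalCDF (c - (x + y))) (integrable_stdNormalCDF_comp (by fun_prop))]
    at h2
  calc _ ≤ _ := abs_sub_le _ _ _
    _ ≤ B + A := add_le_add h1 h2
    _ = A + B := add_comm _ _

section Errors

variable {Ω : Type*} [MeasurableSpace Ω] {P : Measure Ω}

lemma integrable_sq_mul_min {X : Ω → ℝ} (hX : MemLp X 2 P) {δ : ℝ} (hδ : 0 ≤ δ) :
    Integrable (fun ω => X ω ^ 2 * min 1 (δ * |X ω|)) P := by
  have hm := hX.aestronglyMeasurable.aemeasurable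
  refine hX.integrable_sq.mono' (by fun_prop) (ae_of_all _ fun ω => ?_)
  have : 0 ≤ min 1 (δ * |X ω|) := le_min zero_le_one (by positivity)
  rw [Real.norm_eq_abs, abs_of_nonneg (by positivity)]
  exact mul_le_of_le_one_right (sq_nonneg _) (min_le_left _ _)

/-- The linear Taylor term 2 φ(c) X integrates to zero because X is centered; only the truncated
cubic remainder is left. -/
lemma abs_integral_stdNormalCDF_reflect_le [IsProbabilityMeasure P] {X : Ω → ℝ}
    (hX : MemLp X 2 P) (h0 : ∫ ω, X ω ∂P = 0) (c : ℝ) :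
    |∫ ω, stdNormalCDF (c + X ω) ∂P - ∫ ω, stdNormalCDF (c - X ω) ∂P| ≤
      2 * ∫ ω, X ω ^ 2 * min 1 |X ω| ∂P := by
  have hm := hX.aestronglyMeasurable.aemeasurable
  have hXi : Integrable X P := hX.integrable one_le_two
  have h1 := integrable_stdNormalCDF_comp (P := P) (f := fun ω => c + X ω) (by fun_prop)
  have h2 := integrable_stdNormalCDF_comp (P := P) (f := fun ω => c - X ω) (by fun_prop)
  have hr := integrable_sq_mul_min hX zero_le_one
  simp only [one_mul] at hr
  have hXc := hXi.const_mul (2 * stdNormalPDF c)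
  have h12 : Integrable (fun ω => stdNormalCDF (c + X ω) - stdNormalCDF (c - X ω)) P := h1.sub h2
  have : ∫ ω, stdNormalCDF (c + X ω) ∂P - ∫ ω, stdNormalCDF (c - X ω) ∂P =
      ∫ ω, (stdNormalCDF (c + X ω) - stdNormalCDF (c - X ω) - 2 * stdNormalPDF c * X ω) ∂P := by
    rw [integral_sub h12 hXc, integral_sub h1 h2, integral_const_mul, h0, mul_zero, sub_zero]
  rw [this, ← integral_const_mul, ← Real.norm_eq_abs]
  refine norm_integral_le_of_norm_le (hr.const_mul 2) (ae_of_all _ fun ω => ?_)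
  exact abs_stdNormalCDF_add_sub_le c (X ω)

/-- Lindeberg's swapping argument, replacing the summands by their negatives one at a time. -/
lemma abs_integral_stdNormalCDF_sum_reflect_le {ι : Type*} {X : ι → Ω → ℝ} (hX : iIndepFun X P)
    (hL : ∀ i, MemLp (X i) 2 P) (h0 : ∀ i, ∫ ω, X i ω ∂P = 0) (s : Finset ι) (c : ℝ) :
    |∫ ω, stdNormalCDF (c + ∑ i ∈ s, X i ω) ∂P - ∫ ω, stdNormalCDF (c - ∑ i ∈ s, X i ω) ∂P| ≤
      ∑ i ∈ s, 2 * ∫ ω, X i ω ^ 2 * min 1 |X i ω| ∂P := by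
  classical
  have := hX.isProbabilityMeasure
  have hm : ∀ i, AEMeasurable (X i) P := fun i => (hL i).aestronglyMeasurable.aemeasurable
  have hmap : ∀ {Y : Ω → ℝ} (hY : AEMeasurable Y P) (c : ℝ),
      ∫ ω, stdNormalCDF (c + Y ω) ∂P - ∫ ω, stdNormalCDF (c - Y ω) ∂P =
      ∫ x, stdNormalCDF (c + x) ∂(P.map Y) - ∫ x, stdNormalCDF (c - x) ∂(P.map Y) := by
    intro Y hY c
    have hc := continuous_stdNormalCDF
    rw [integral_map hY (Continuous.aestronglyMeasurable (by fun_prop)),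
      integral_map hY (Continuous.aestronglyMeasurable (by fun_prop))]
  induction s using Finset.induction_on generalizing c with
  | empty => simp
  | insert j s hj ih =>
    have hs : AEMeasurable (∑ i ∈ s, X i) P := Finset.aemeasurable_sum _ fun i _ => hm i
    have hjs : AEMeasurable (∑ i ∈ insert j s, X i) P := Finset.aemeasurable_sum _ fun i _ => hm i
    have hconv : P.map (∑ i ∈ insert j s, X i) = (P.map (∑ i ∈ s, X i)).conv (P.map (X j)) := by
      rw [Finset.sum_insert hj, add_comm]
      exact (hX.indepFun_finsetSum_of_notMem₀ hm hj).map_add_eq_map_conv_map₀ hs (hm j)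
    have := Measure.isProbabilityMeasure_map hs
    have := Measure.isProbabilityMeasure_map (hm j)
    have e := hmap hjs c
    simp only [Finset.sum_apply] at e
    rw [e, hconv, Finset.sum_insert hj, add_comm (2 * _)]
    refine abs_integral_stdNormalCDF_conv_le (fun c => ?_) (fun c => ?_) c
    · rw [← hmap hs]
      simpa only [Finset.sum_apply] using ih c
    · rw [← hmap (hm j)]
      exact abs_integral_stdNormalCDF_reflect_le (hL j) (h0 j) c

variable {ν : Measure ℝ} {ι : Type*} [Fintype ι] {ε : ι → Ω → ℝ}

lemma memLp_of_hasLaw {X : Ω → ℝ} (h : HasLaw X ν P) (hν : MemLp (fun t : ℝ => t) 2 ν) :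
    MemLp X 2 P := by
  rw [← h.map_eq] at hν
  exact hν.comp_of_map h.aemeasurable

/-- A weighted sum of centered independent errors, each with a small weight, has an almost centered
normal score. -/
lemma abs_integral_stdNormalCDF_weighted_sub_half_le (hν : MemLp (fun t : ℝ => t) 2 ν)
    (hν0 : ∫ t, t ∂ν = 0) (hlaw : ∀ i, HasLaw (ε i) ν P) (hind : iIndepFun ε P)
    {a : ι → ℝ} {δ V : ℝ} (hδ : 0 ≤ δ) (ha : ∀ i, |a i| ≤ δ) (hV : ∑ i, a i ^ 2 ≤ V) :
    |∫ ω, stdNormalCDF (∑ i, a i * ε i ω) ∂P - 1 / 2| ≤ V * ∫ t, t ^ 2 * min 1 (δ * |t|) ∂ν := by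
  have := hind.isProbabilityMeasure
  have hm : ∀ i, AEMeasurable (ε i) P := fun i => (hlaw i).aemeasurable
  have hL : ∀ i, MemLp (fun ω => a i * ε i ω) 2 P :=
    fun i => (memLp_of_hasLaw (hlaw i) hν).const_mul (a i)
  -- At shift 0, the identity Φ(-x) = 1 - Φ(x) turns the reflection defect into twice the deviation
  -- of the expected score from 1/2.
  have h := abs_integral_stdNormalCDF_sum_reflect_le (X := fun i ω => a i * ε i ω)
    (hind.comp (fun i t => a i * t) (fun i => by fun_prop)) hL
    (fun i => by
      have := (hlaw i).integral_eq
      rw [integral_const_mul, this]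
      simp [hν0]) Finset.univ 0
  simp only [zero_add, zero_sub, stdNormalCDF_neg] at h
  have hi : Integrable (fun ω => stdNormalCDF (∑ i, a i * ε i ω)) P :=
    integrable_stdNormalCDF_comp (by fun_prop)
  rw [integral_sub (integrable_const _) hi] at h
  simp only [integral_const, probReal_univ, smul_eq_mul, mul_one] at h
  have hI : 0 ≤ ∫ t, t ^ 2 * min 1 (δ * |t|) ∂ν := integral_nonneg fun t =>
    mul_nonneg (sq_nonneg _) (le_min zero_le_one (by positivity))
  have hterm : ∀ i, ∫ ω, (a i * ε i ω) ^ 2 * min 1 |a i * ε i ω| ∂P ≤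
      a i ^ 2 * ∫ t, t ^ 2 * min 1 (δ * |t|) ∂ν := by
    intro i
    have e : ∫ ω, ε i ω ^ 2 * min 1 (δ * |ε i ω|) ∂P = ∫ t, t ^ 2 * min 1 (δ * |t|) ∂ν :=
      (hlaw i).integral_comp (f := fun t => t ^ 2 * min 1 (δ * |t|))
        (Continuous.aestronglyMeasurable (by fun_prop))
    rw [← e, ← integral_const_mul]
    have hr := integrable_sq_mul_min (hL i) zero_le_one
    simp only [one_mul] at hr
    refine integral_mono hr
      ((integrable_sq_mul_min (memLp_of_hasLaw (hlaw i) hν) hδ).const_mul _) fun ω => ?_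
    simp only
    rw [mul_pow, mul_assoc, abs_mul]
    gcongr
    exact ha i
  have hsum : ∑ i, 2 * ∫ ω, (a i * ε i ω) ^ 2 * min 1 |a i * ε i ω| ∂P ≤
      2 * (V * ∫ t, t ^ 2 * min 1 (δ * |t|) ∂ν) := by
    rw [← Finset.mul_sum]
    gcongr
    calc _ ≤ ∑ i, a i ^ 2 * ∫ t, t ^ 2 * min 1 (δ * |t|) ∂ν :=
          Finset.sum_le_sum fun i _ => hterm i
      _ = (∑ i, a i ^ 2) * ∫ t, t ^ 2 * min 1 (δ * |t|) ∂ν := by rw [Finset.sum_mul]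
      _ ≤ _ := by gcongr
  rw [show ∀ r : ℝ, r - (1 - r) = 2 * (r - 1 / 2) from fun r => by ring, abs_mul,
    abs_of_pos (two_pos : (0 : ℝ) < 2)] at h
  linarith

/-- The Lindeberg condition for one fixed law, by domination with t². The filter is one-sided
because the truncated factor lies in [0, 1] only for δ ≥ 0. -/
lemma tendsto_integral_sq_mul_min (hν : MemLp (fun t : ℝ => t) 2 ν) :
    Tendsto (fun δ => ∫ t, t ^ 2 * min 1 (δ * |t|) ∂ν) (𝓝[≥] 0) (𝓝 0) := by
  have : Tendsto (fun δ => ∫ t, t ^ 2 * min 1 (δ * |t|) ∂ν) (𝓝[≥] 0) (𝓝 (∫ _, (0 : ℝ) ∂ν)) := by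
    refine tendsto_integral_filter_of_dominated_convergence (fun t => t ^ 2)
      (Eventually.of_forall fun δ => Continuous.aestronglyMeasurable (by fun_prop)) ?_
      hν.integrable_sq (ae_of_all _ fun t => ?_)
    · filter_upwards [self_mem_nhdsWithin] with δ (hδ : 0 ≤ δ)
      refine ae_of_all _ fun t => ?_
      have : 0 ≤ min 1 (δ * |t|) := le_min zero_le_one (by positivity)
      rw [Real.norm_eq_abs, abs_of_nonneg (by positivity)]
      exact mul_le_of_le_one_right (sq_nonneg _) (min_le_left _ _)
    · have hc : Continuous fun δ : ℝ => t ^ 2 * min 1 (δ * |t|) := by fun_prop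
      have := hc.tendsto 0
      simp only [zero_mul, min_eq_right zero_le_one, mul_zero] at this
      exact this.mono_left nhdsWithin_le_nhds
  simpa using this

/-- A weighted sum of centered independent errors with a large shift has a normal score close
to one. -/
lemma abs_integral_stdNormalCDF_add_weighted_sub_one_le (hν : MemLp (fun t : ℝ => t) 2 ν)
    (hν0 : ∫ t, t ∂ν = 0) (hlaw : ∀ i, HasLaw (ε i) ν P) (hind : iIndepFun ε P)
    {a : ι → ℝ} {V B B₀ : ℝ} (hV : ∑ i, a i ^ 2 ≤ V) (hB₀ : 0 < B₀) (hB : B₀ ≤ B) :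
    |∫ ω, stdNormalCDF (B + ∑ i, a i * ε i ω) ∂P - 1| ≤
      (1 - stdNormalCDF (B₀ / 2)) + 4 * (V * ∫ t, t ^ 2 ∂ν) / B₀ ^ 2 := by
  have := hind.isProbabilityMeasure
  have hm : ∀ i, AEMeasurable (ε i) P := fun i => (hlaw i).aemeasurable
  have hL : ∀ i, MemLp (fun ω => a i * ε i ω) 2 P :=
    fun i => (memLp_of_hasLaw (hlaw i) hν).const_mul (a i)
  have h0 : ∀ i, ∫ ω, ε i ω ∂P = 0 := fun i => by rw [(hlaw i).integral_eq]; simpa using hν0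
  have hLs : MemLp (fun ω => ∑ i, a i * ε i ω) 2 P := memLp_finsetSum _ fun i _ => hL i
  have hs0 : ∫ ω, ∑ i, a i * ε i ω ∂P = 0 := by
    rw [integral_finsetSum _ fun i _ => (hL i).integrable one_le_two]
    exact Finset.sum_eq_zero fun i _ => by rw [integral_const_mul, h0, mul_zero]
  have hvar : ∫ ω, (∑ i, a i * ε i ω) ^ 2 ∂P ≤ V * ∫ t, t ^ 2 ∂ν := by
    have hind' : iIndepFun (fun i ω => a i * ε i ω) P :=
      hind.comp (fun i t => a i * t) (fun i => by fun_prop)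
    have h1 := IndepFun.variance_sum (μ := P) (s := Finset.univ)
      (X := fun i ω => a i * ε i ω) (fun i _ => hL i)
      (fun i _ j _ hij => hind'.indepFun hij)
    have e : (∑ i, fun ω => a i * ε i ω) = fun ω => ∑ i, a i * ε i ω := by
      ext ω; simp
    rw [e, variance_of_integral_eq_zero hLs.aestronglyMeasurable.aemeasurable hs0] at h1
    rw [h1]
    have h2 : ∀ i, Var[fun ω => a i * ε i ω; P] = a i ^ 2 * ∫ t, t ^ 2 ∂ν := by
      intro i
      rw [variance_const_mul, variance_of_integral_eq_zero (hm i) (h0 i)]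
      congr 1
      exact (hlaw i).integral_comp (f := fun t => t ^ 2)
        (Continuous.aestronglyMeasurable (by fun_prop))
    simp only [h2, ← Finset.sum_mul]
    gcongr
  have hi : Integrable (fun ω => stdNormalCDF (B + ∑ i, a i * ε i ω)) P :=
    integrable_stdNormalCDF_comp (by fun_prop)
  have hle : ∫ ω, stdNormalCDF (B + ∑ i, a i * ε i ω) ∂P ≤ 1 := by
    simpa using integral_mono hi (integrable_const 1) fun ω => stdNormalCDF_le_one _
  rw [abs_sub_comm, abs_of_nonneg (by linarith)]
  have hsq := hLs.integrable_sq
  calc 1 - ∫ ω, stdNormalCDF (B + ∑ i, a i * ε i ω) ∂P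
      = ∫ ω, (1 - stdNormalCDF (B + ∑ i, a i * ε i ω)) ∂P := by
        rw [integral_sub (integrable_const _) hi]; simp
    _ ≤ ∫ ω, ((1 - stdNormalCDF (B₀ / 2)) + 4 / B₀ ^ 2 * (∑ i, a i * ε i ω) ^ 2) ∂P := by
        refine integral_mono ((integrable_const _).sub hi)
          ((integrable_const _).add (hsq.const_mul _)) fun ω => ?_
        simp only
        set z := ∑ i, a i * ε i ω
        -- Either the noise leaves at least half of the shift, and monotonicity of Φ applies, or it
        -- exceeds half of the shift and the Chebyshev term is at least 1.
        rcases le_or_gt (-(B₀ / 2)) z with hz | hz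
        · have := monotone_stdNormalCDF (show B₀ / 2 ≤ B + z by linarith)
          have : 0 ≤ 4 / B₀ ^ 2 * z ^ 2 := by positivity
          linarith
        · have h1 : 1 ≤ 4 / B₀ ^ 2 * z ^ 2 := by
            rw [div_mul_eq_mul_div, one_le_div (by positivity)]
            nlinarith
          have := stdNormalCDF_nonneg (B + z)
          have := stdNormalCDF_le_one (B₀ / 2)
          linarith
    _ = (1 - stdNormalCDF (B₀ / 2)) + 4 / B₀ ^ 2 * ∫ ω, (∑ i, a i * ε i ω) ^ 2 ∂P := by
        rw [integral_add (integrable_const _) (hsq.const_mul _), integral_const_mul]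
        simp
    _ ≤ (1 - stdNormalCDF (B₀ / 2)) + 4 / B₀ ^ 2 * (V * ∫ t, t ^ 2 ∂ν) := by gcongr
    _ = _ := by ring

end Errors

/-! ### The design grid -/

lemma card_filter_natCast_mem_Icc_le (s : Finset ℕ) {a b : ℝ} (hab : a ≤ b) :
    ((s.filter fun k : ℕ => (k : ℝ) ∈ Icc a b).card : ℝ) ≤ b - a + 1 := by
  have h1 : (s.filter fun k : ℕ => (k : ℝ) ∈ Icc a b).card ≤ (Finset.Icc ⌈a⌉ ⌊b⌋).card := by
    refine Finset.card_le_card_of_injOn (fun k : ℕ => (k : ℤ)) (fun k hk => ?_)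
      (fun _ _ _ _ h => Nat.cast_injective h)
    have hk := (Finset.mem_filter.1 hk).2
    simp only [Finset.coe_Icc, mem_Icc, Int.ceil_le, Int.le_floor]
    exact_mod_cast hk
  have h2 : ((Finset.Icc ⌈a⌉ ⌊b⌋).card : ℝ) = max ((⌊b⌋ + 1 - ⌈a⌉ : ℤ) : ℝ) 0 := by
    rw [Int.card_Icc, ← Int.cast_natCast, Int.toNat_eq_max]
    push_cast
    rfl
  calc _ ≤ ((Finset.Icc ⌈a⌉ ⌊b⌋).card : ℝ) := by exact_mod_cast h1
    _ = max ((⌊b⌋ + 1 - ⌈a⌉ : ℤ) : ℝ) 0 := h2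
    _ ≤ b - a + 1 := by
      refine max_le ?_ (by linarith)
      push_cast
      linarith [Int.floor_le b, Int.le_ceil a]

lemma le_card_filter_natCast_mem_Icc {m : ℕ} {a b : ℝ} (ha : 1 ≤ a) (hb : b ≤ m) :
    b - a - 1 ≤ (((Finset.Icc 1 m).filter fun k : ℕ => (k : ℝ) ∈ Icc a b).card : ℝ) := by
  have h1 : Finset.Icc ⌈a⌉₊ ⌊b⌋₊ ⊆ (Finset.Icc 1 m).filter fun k : ℕ => (k : ℝ) ∈ Icc a b := by
    intro k hk
    rw [Finset.mem_Icc, Nat.ceil_le] at hk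
    -- The natural floor of a negative b is 0, so membership would force k = 0, against 1 ≤ a.
    rcases lt_or_ge b 0 with hb0 | hb0
    · have h0 : k = 0 := by simpa [Nat.floor_of_nonpos hb0.le] using hk.2
      rw [h0] at hk
      norm_num at hk
      linarith
    rw [Nat.le_floor_iff hb0] at hk
    refine Finset.mem_filter.2 ⟨Finset.mem_Icc.2 ⟨?_, ?_⟩, hk⟩
    · exact_mod_cast ha.trans hk.1
    · exact_mod_cast hk.2.trans hb
  have h2 := Finset.card_le_card h1
  rw [Nat.card_Icc] at h2
  have h3 : ((⌊b⌋₊ + 1 : ℕ) : ℝ) ≤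
      (((Finset.Icc 1 m).filter fun k : ℕ => (k : ℝ) ∈ Icc a b).card + ⌈a⌉₊ : ℕ) := by
    exact_mod_cast (by omega : ⌊b⌋₊ + 1 ≤ _)
  push_cast at h3
  have h4 := Nat.lt_floor_add_one b
  have h5 := Nat.ceil_lt_add_one (show 0 ≤ a by linarith)
  linarith

lemma filter_gridIndex (m : ℕ) (p q : ℕ → Prop) [DecidablePred p] [DecidablePred q] :
    ((gridIndex m).filter fun i => p i.1 ∧ q i.2) =
      (Finset.Icc 1 m).filter p ×ˢ (Finset.Icc 1 m).filter q :=
  Finset.filter_product p q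

lemma card_gridIndex (m : ℕ) : (gridIndex m).card = m ^ 2 := by
  simp [gridIndex, sq]

open Classical in
/-- The number of design points in a closed square. -/
lemma card_filter_designPoint_mem_closedBall_le (m : ℕ) (x : ℝ × ℝ) {r : ℝ} (hr : 0 ≤ r) :
    (((gridIndex m).filter fun i => designPoint m i ∈ Metric.closedBall x r).card : ℝ) ≤
      (2 * r * m + 1) ^ 2 := by
  rcases Nat.eq_zero_or_pos m with rfl | hm
  · simp [gridIndex]
  have hm' : (0 : ℝ) < m := by exact_mod_cast hm
  -- The distance on `ℝ × ℝ` is the sup distance, so the ball is a square and the count factorizes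
  -- over the coordinates.
  have h1 : ((gridIndex m).filter fun i => designPoint m i ∈ Metric.closedBall x r) =
      (gridIndex m).filter fun i => (i.1 : ℝ) ∈ Icc (m * (x.1 - r)) (m * (x.1 + r)) ∧
        (i.2 : ℝ) ∈ Icc (m * (x.2 - r)) (m * (x.2 + r)) := by
    have key : ∀ (k : ℕ) (t : ℝ), |(k : ℝ) / m - t| ≤ r ↔
        (k : ℝ) ∈ Icc (m * (t - r)) (m * (t + r)) := by
      intro k t
      rw [abs_sub_le_iff, mem_Icc, sub_le_iff_le_add, div_le_iff₀ hm', sub_le_comm, le_div_iff₀ hm']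
      constructor <;> rintro ⟨h1, h2⟩ <;> constructor <;> linarith
    refine Finset.filter_congr fun i _ => ?_
    rw [Metric.mem_closedBall, Prod.dist_eq, max_le_iff, Real.dist_eq, Real.dist_eq]
    exact and_congr (key _ _) (key _ _)
  rw [h1, filter_gridIndex m (fun k : ℕ => (k : ℝ) ∈ Icc (m * (x.1 - r)) (m * (x.1 + r)))
    (fun k : ℕ => (k : ℝ) ∈ Icc (m * (x.2 - r)) (m * (x.2 + r))), Finset.card_product, Nat.cast_mul, sq]
  have key : ∀ t : ℝ, (((Finset.Icc 1 m).filter fun k : ℕ =>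
      (k : ℝ) ∈ Icc (m * (t - r)) (m * (t + r))).card : ℝ) ≤ 2 * r * m + 1 := by
    intro t
    refine (card_filter_natCast_mem_Icc_le _ (by gcongr; linarith)).trans (le_of_eq ?_)
    ring
  exact mul_le_mul (key _) (key _) (Nat.cast_nonneg _) (by positivity)

/-- The index of the cell of mesh `1 / m` that contains `x`. -/
noncomputable def cellIndex (m : ℕ) (x : ℝ × ℝ) : ℕ × ℕ := (⌈m * x.1⌉₊, ⌈m * x.2⌉₊)

/-- The half-open unit square. -/
def halfOpenSquare : Set (ℝ × ℝ) := Ioc 0 1 ×ˢ Ioc 0 1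

lemma cellIndex_mem_gridIndex {m : ℕ} (hm : 0 < m) {x : ℝ × ℝ} (hx : x ∈ halfOpenSquare) :
    cellIndex m x ∈ gridIndex m := by
  have hm' : (0 : ℝ) < m := by exact_mod_cast hm
  have key : ∀ t ∈ Ioc (0 : ℝ) 1, ⌈m * t⌉₊ ∈ Finset.Icc 1 m := by
    intro t ht
    rw [Finset.mem_Icc, Nat.one_le_ceil_iff, Nat.ceil_le]
    exact ⟨mul_pos hm' ht.1, mul_le_of_le_one_right hm'.le ht.2⟩
  exact Finset.mem_product.2 ⟨key _ hx.1, key _ hx.2⟩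

lemma dist_designPoint_cellIndex_le {m : ℕ} (hm : 0 < m) {x : ℝ × ℝ} (hx : x ∈ halfOpenSquare) :
    dist (designPoint m (cellIndex m x)) x ≤ 1 / m := by
  have hm' : (0 : ℝ) < m := by exact_mod_cast hm
  have key : ∀ t ∈ Ioc (0 : ℝ) 1, dist ((⌈m * t⌉₊ : ℝ) / m) t ≤ 1 / m := by
    intro t ht
    have h1 := Nat.le_ceil (m * t)
    have h2 := Nat.ceil_lt_add_one (mul_nonneg hm'.le ht.1.le)
    rw [Real.dist_eq, show (⌈m * t⌉₊ : ℝ) / m - t = (⌈m * t⌉₊ - m * t) / m by field_simp,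
      abs_of_nonneg (div_nonneg (by linarith) hm'.le)]
    gcongr
    linarith
  rw [Prod.dist_eq]
  exact max_le (key _ hx.1) (key _ hx.2)

lemma tendsto_designPoint_cellIndex {x : ℝ × ℝ} (hx : x ∈ halfOpenSquare) :
    Tendsto (fun m => designPoint m (cellIndex m x)) atTop (𝓝 x) := by
  rw [tendsto_iff_dist_tendsto_zero]
  refine squeeze_zero' (Eventually.of_forall fun _ => dist_nonneg) ?_ tendsto_one_div_atTop_nhds_zero_nat
  filter_upwards [eventually_gt_atTop 0] with m hm
  exact dist_designPoint_cellIndex_le hm hx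

lemma designPoint_mem_halfOpenSquare {m : ℕ} {i : ℕ × ℕ} (hi : i ∈ gridIndex m) :
    designPoint m i ∈ halfOpenSquare := by
  have key : ∀ k ∈ Finset.Icc 1 m, (k : ℝ) / m ∈ Ioc (0 : ℝ) 1 := by
    intro k hk
    rw [Finset.mem_Icc] at hk
    have h1 : (0 : ℝ) < k := by exact_mod_cast hk.1
    have h2 : (k : ℝ) ≤ m := by exact_mod_cast hk.2
    exact ⟨div_pos h1 (h1.trans_le h2), div_le_one_of_le₀ h2 (h1.le.trans h2)⟩
  rw [gridIndex, Finset.mem_product] at hi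
  exact ⟨key _ hi.1, key _ hi.2⟩

lemma halfOpenSquare_subset_unitSquare : halfOpenSquare ⊆ unitSquare :=
  prod_mono Ioc_subset_Icc_self Ioc_subset_Icc_self

/-! ### The weights of the kernel estimate -/

section Kernel

variable {K₀ : ℝ → ℝ} {L₀ : ℝ}

lemma IsSmoothingKernel.productKernel_nonneg (hK : IsSmoothingKernel K₀ L₀) (x : ℝ × ℝ) :
    0 ≤ productKernel K₀ x := mul_nonneg (hK.nonneg _) (hK.nonneg _)

lemma IsSmoothingKernel.norm_lt_of_productKernel_ne_zero (hK : IsSmoothingKernel K₀ L₀)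
    {x : ℝ × ℝ} (hx : productKernel K₀ x ≠ 0) : ‖x‖ < L₀ := by
  rw [Prod.norm_def, max_lt_iff]
  constructor <;> by_contra! h
  · exact hx (by rw [productKernel, hK.eq_zero _ h, zero_mul])
  · exact hx (by rw [productKernel, hK.eq_zero _ h, mul_zero])

lemma IsSmoothingKernel.continuous_productKernel (hK : IsSmoothingKernel K₀ L₀) :
    Continuous (productKernel K₀) := by
  obtain ⟨C, hC⟩ := hK.lipschitz
  exact hC.continuous

lemma IsSmoothingKernel.exists_productKernel_le (hK : IsSmoothingKernel K₀ L₀) :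
    ∃ C, 0 < C ∧ ∀ x, productKernel K₀ x ≤ C := by
  obtain ⟨C, hC⟩ := (isCompact_closedBall (0 : ℝ × ℝ) L₀).bddAbove_image
    hK.continuous_productKernel.continuousOn
  refine ⟨max C 1, by positivity, fun x => ?_⟩
  by_cases hx : productKernel K₀ x = 0
  · rw [hx]; positivity
  · refine (hC (mem_image_of_mem _ ?_)).trans (le_max_left _ _)
    simpa using (hK.norm_lt_of_productKernel_ne_zero hx).le

/-- Total mass one gives some t with K₀(t) > 0. At the diagonal point (t, t) the product is K₀(t)² >
0, and only the product is known to be continuous. -/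
lemma IsSmoothingKernel.exists_le_productKernel (hK : IsSmoothingKernel K₀ L₀) :
    ∃ t r κ : ℝ, 0 < r ∧ 0 < κ ∧ ∀ x ∈ Metric.closedBall (t, t) r, κ ≤ productKernel K₀ x := by
  obtain ⟨t, ht⟩ : ∃ t, 0 < K₀ t := by
    by_contra! h
    have : K₀ = fun _ => 0 := funext fun t => le_antisymm (h t) (hK.nonneg t)
    have h1 := hK.integral_eq_one
    simp [this] at h1
  have hpos : 0 < productKernel K₀ (t, t) := mul_pos ht ht
  have := hK.continuous_productKernel.continuousAt.eventually (lt_mem_nhds (half_lt_self hpos))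
  obtain ⟨r, hr, h⟩ := Metric.nhds_basis_closedBall.eventually_iff.1 this
  exact ⟨t, r, _, hr, half_pos hpos, fun x hx => (h hx).le⟩

/-- The weight of the observation at `x_j` in the standardized kernel estimate at `x`. -/
noncomputable def kernelWeight (K₀ : ℝ → ℝ) (h : ℝ) (m : ℕ) (x : ℝ × ℝ) (j : ℕ × ℕ) : ℝ :=
  (m * h)⁻¹ * productKernel K₀ (h⁻¹ • (x - designPoint m j))

lemma sqrt_mul_kernelEstimate {h : ℝ} (hh : 0 < h) (m : ℕ) (y : ℕ × ℕ → ℝ) (x : ℝ × ℝ) :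
    √((m : ℝ) ^ 2 * h ^ 2) * kernelEstimate K₀ h m y x =
      ∑ j : gridIndex m, kernelWeight K₀ h m x j * y j := by
  rw [Finset.sum_coe_sort (gridIndex m) fun j => kernelWeight K₀ h m x j * y j, kernelEstimate,
    ← mul_pow, Real.sqrt_sq (by positivity), ← mul_assoc, Finset.mul_sum]
  refine Finset.sum_congr rfl fun j _ => ?_
  rw [kernelWeight]
  rcases Nat.eq_zero_or_pos m with rfl | hm
  · simp
  · field_simp

lemma IsSmoothingKernel.kernelWeight_nonneg (hK : IsSmoothingKernel K₀ L₀) {h : ℝ} (hh : 0 < h)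
    (m : ℕ) (x : ℝ × ℝ) (j : ℕ × ℕ) : 0 ≤ kernelWeight K₀ h m x j :=
  mul_nonneg (by positivity) (hK.productKernel_nonneg _)

lemma IsSmoothingKernel.dist_lt_of_kernelWeight_ne_zero (hK : IsSmoothingKernel K₀ L₀) {h : ℝ}
    (hh : 0 < h) {m : ℕ} {x : ℝ × ℝ} {j : ℕ × ℕ} (hj : kernelWeight K₀ h m x j ≠ 0) :
    dist (designPoint m j) x < L₀ * h := by
  have := hK.norm_lt_of_productKernel_ne_zero (right_ne_zero_of_mul hj)
  rw [norm_smul, norm_inv, Real.norm_of_nonneg hh.le, inv_mul_lt_iff₀ hh, ← dist_eq_norm,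
    dist_comm] at this
  linarith

lemma abs_kernelWeight_le {C : ℝ} (hK : IsSmoothingKernel K₀ L₀)
    (hC : ∀ x, productKernel K₀ x ≤ C) {h : ℝ} (hh : 0 < h) (m : ℕ) (x : ℝ × ℝ) (j : ℕ × ℕ) :
    |kernelWeight K₀ h m x j| ≤ C / (m * h) := by
  rw [abs_of_nonneg (hK.kernelWeight_nonneg hh m x j), kernelWeight, div_eq_inv_mul]
  gcongr
  exact hC _

/-- The support contains O((mh)²) design points and each weight is O(1/(mh)), so the noise variance
stays bounded. The condition 1 ≤ mh absorbs the +1 of the count. -/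
lemma sum_kernelWeight_sq_le {C : ℝ} (hK : IsSmoothingKernel K₀ L₀)
    (hC : ∀ x, productKernel K₀ x ≤ C) {h : ℝ} (hh : 0 < h) {m : ℕ} (hmh : 1 ≤ m * h)
    (x : ℝ × ℝ) : ∑ j : gridIndex m, kernelWeight K₀ h m x j ^ 2 ≤ (C * (2 * L₀ + 1)) ^ 2 := by
  classical
  have hL := hK.radius_pos
  rw [Finset.sum_coe_sort (gridIndex m) fun j => kernelWeight K₀ h m x j ^ 2]
  have hsub : (gridIndex m).filter (fun j => kernelWeight K₀ h m x j ^ 2 ≠ 0) ⊆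
      (gridIndex m).filter fun j => designPoint m j ∈ Metric.closedBall x (L₀ * h) := by
    refine Finset.monotone_filter_right _ fun j _ hj => ?_
    exact (hK.dist_lt_of_kernelWeight_ne_zero hh (pow_ne_zero_iff two_ne_zero |>.1 hj)).le
  have hcard : (((gridIndex m).filter fun j => kernelWeight K₀ h m x j ^ 2 ≠ 0).card : ℝ) ≤
      (2 * (L₀ * h) * m + 1) ^ 2 :=
    (Nat.cast_le.2 (Finset.card_le_card hsub)).trans
      (card_filter_designPoint_mem_closedBall_le m x (by positivity))
  have hsq : ∀ j, kernelWeight K₀ h m x j ^ 2 ≤ (C / (m * h)) ^ 2 := fun j => by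
    rw [← sq_abs]
    exact pow_le_pow_left₀ (abs_nonneg _) (abs_kernelWeight_le hK hC hh m x j) 2
  rw [← Finset.sum_filter_ne_zero]
  have hC0 : 0 ≤ C := (hK.productKernel_nonneg 0).trans (hC 0)
  calc _ ≤ (((gridIndex m).filter fun j => kernelWeight K₀ h m x j ^ 2 ≠ 0).card : ℝ) *
          (C / (m * h)) ^ 2 := by
        rw [← nsmul_eq_mul]
        exact Finset.sum_le_card_nsmul _ _ _ fun j _ => hsq j
    _ ≤ (2 * (L₀ * h) * m + 1) ^ 2 * (C / (m * h)) ^ 2 := by gcongr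
    _ = (C * ((2 * L₀ * (m * h) + 1) / (m * h))) ^ 2 := by ring
    _ ≤ (C * (2 * L₀ + 1)) ^ 2 := by
        gcongr
        rw [div_le_iff₀ (by linarith)]
        linarith

/-- If the regression function is at least `η` on the window of `x`, then the standardized signal
at `x` is of the order `m h`. -/
lemma exists_le_sum_kernelWeight_mul (hK : IsSmoothingKernel K₀ L₀) :
    ∃ c > 0, ∃ R : ℝ, 0 ≤ R ∧ ∀ (h : ℝ) (m : ℕ) (x : ℝ × ℝ) (μ : ℝ × ℝ → ℝ) (η : ℝ), 0 < h →
      R ≤ m * h → x ∈ Icc (R * h + 1 / m) (1 - R * h) ×ˢ Icc (R * h + 1 / m) (1 - R * h) →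
      0 ≤ η → (∀ z ∈ halfOpenSquare, dist z x < L₀ * h → η ≤ μ z) →
      η * (c * (m * h)) ≤
        ∑ j : gridIndex m, kernelWeight K₀ h m x j * μ (designPoint m j) := by
  classical
  obtain ⟨t, r, κ, hr, hκ, hb⟩ := hK.exists_le_productKernel
  -- The first bound makes r·mh ≥ 1, which pays for the -1 in the lattice count; the second keeps
  -- the chosen index intervals within [1, m].
  obtain ⟨R, hR, hRt⟩ : ∃ R, 1 / r ≤ R ∧ |t| + r ≤ R := ⟨_, le_max_left _ _, le_max_right _ _⟩
  refine ⟨κ * r ^ 2, by positivity, R, le_trans (by positivity) hR, ?_⟩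
  intro h m x μ η hh hRm hx hη hμ
  have hRr := hR.trans hRm
  have hmh : 0 < m * h := lt_of_lt_of_le (by positivity) hRr
  have hm : (0 : ℝ) < m := pos_of_mul_pos_left hmh hh.le
  rw [div_le_iff₀ hr] at hRr
  rw [Finset.sum_coe_sort (gridIndex m) fun j => kernelWeight K₀ h m x j * μ (designPoint m j)]
  -- The endpoints solve |(s - k/m)/h - t| ≤ r for k. The interval has length 2r·mh, hence contains
  -- at least r·mh indices.
  obtain ⟨lo, hlo⟩ : ∃ lo : ℝ → ℝ, ∀ s, lo s = m * s - (t + r) * (m * h) := ⟨_, fun _ => rfl⟩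
  obtain ⟨hi, hhi⟩ : ∃ hi : ℝ → ℝ, ∀ s, hi s = m * s - (t - r) * (m * h) := ⟨_, fun _ => rfl⟩
  set G := (gridIndex m).filter fun j => (j.1 : ℝ) ∈ Icc (lo x.1) (hi x.1) ∧
    (j.2 : ℝ) ∈ Icc (lo x.2) (hi x.2) with hG
  have hcard : (r * (m * h)) ^ 2 ≤ (G.card : ℝ) := by
    rw [hG, filter_gridIndex m (fun k : ℕ => (k : ℝ) ∈ Icc (lo x.1) (hi x.1))
      (fun k : ℕ => (k : ℝ) ∈ Icc (lo x.2) (hi x.2)), Finset.card_product, Nat.cast_mul, sq]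
    have key : ∀ s ∈ Icc (R * h + 1 / m) (1 - R * h), r * (m * h) ≤
        ((((Finset.Icc 1 m).filter fun k : ℕ => (k : ℝ) ∈ Icc (lo s) (hi s)).card : ℕ) : ℝ) := by
      intro s hs
      have h1 : t + r ≤ R := by linarith [le_abs_self t]
      have h2 : -R ≤ t - r := by linarith [neg_abs_le t]
      have h3 := mul_le_mul_of_nonneg_left hs.1 hm.le
      have h4 := mul_le_mul_of_nonneg_left hs.2 hm.le
      have h5 := mul_le_mul_of_nonneg_right h1 hmh.le
      have h6 := mul_le_mul_of_nonneg_right h2 hmh.le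
      have h7 : (m : ℝ) * (1 / m) = 1 := by field_simp
      refine le_trans ?_ (le_card_filter_natCast_mem_Icc ?_ ?_)
      · rw [hlo, hhi]
        linarith
      · rw [hlo]
        linarith
      · rw [hhi]
        linarith
    exact mul_le_mul (key _ hx.1) (key _ hx.2) (by positivity) (by positivity)
  have hterm : ∀ j ∈ gridIndex m, 0 ≤ kernelWeight K₀ h m x j * μ (designPoint m j) := by
    intro j hj
    by_cases h0 : kernelWeight K₀ h m x j = 0
    · rw [h0, zero_mul]
    · exact mul_nonneg (hK.kernelWeight_nonneg hh m x j) (hη.trans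
        (hμ _ (designPoint_mem_halfOpenSquare hj) (hK.dist_lt_of_kernelWeight_ne_zero hh h0)))
  have hG' : ∀ j ∈ G, (m * h)⁻¹ * κ * η ≤ kernelWeight K₀ h m x j * μ (designPoint m j) := by
    intro j hj
    obtain ⟨hj, hj1, hj2⟩ := Finset.mem_filter.1 hj
    have hκj : κ ≤ productKernel K₀ (h⁻¹ • (x - designPoint m j)) := by
      refine hb _ ?_
      have key : ∀ (s : ℝ) (k : ℕ), (k : ℝ) ∈ Icc (lo s) (hi s) → |h⁻¹ * (s - k / m) - t| ≤ r := by
        intro s k hk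
        have e : h⁻¹ * (s - k / m) - t = (m * s - k - t * (m * h)) / (m * h) := by
          field_simp
        rw [e, abs_div, abs_of_pos hmh, div_le_iff₀ hmh, abs_le]
        have h1 := hk.1
        have h2 := hk.2
        rw [hlo] at h1
        rw [hhi] at h2
        constructor <;> linarith
      rw [Metric.mem_closedBall, Prod.dist_eq, max_le_iff, Real.dist_eq, Real.dist_eq]
      exact ⟨key _ _ hj1, key _ _ hj2⟩
    have hw : (m * h)⁻¹ * κ ≤ kernelWeight K₀ h m x j := by
      rw [kernelWeight]
      gcongr
    have h0 : kernelWeight K₀ h m x j ≠ 0 := (lt_of_lt_of_le (by positivity) hw).ne'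
    have := hμ _ (designPoint_mem_halfOpenSquare hj) (hK.dist_lt_of_kernelWeight_ne_zero hh h0)
    exact mul_le_mul hw this hη (hK.kernelWeight_nonneg hh m x j)
  calc η * (κ * r ^ 2 * (m * h)) = (r * (m * h)) ^ 2 * ((m * h)⁻¹ * κ * η) := by
        field_simp
    _ ≤ G.card * ((m * h)⁻¹ * κ * η) := by gcongr
    _ ≤ ∑ j ∈ G, kernelWeight K₀ h m x j * μ (designPoint m j) := by
        rw [← nsmul_eq_mul]
        exact Finset.card_nsmul_le_sum _ _ _ hG'
    _ ≤ _ := Finset.sum_le_sum_of_subset_of_nonneg (Finset.filter_subset _ _)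
        fun j hj _ => hterm j hj

end Kernel

/-! ### The bandwidth -/

lemma tendsto_bandwidth (h₀ : ℝ) {β : ℝ} (hβ : 0 < β) :
    Tendsto (bandwidth h₀ β) atTop (𝓝 0) := by
  have h1 : Tendsto (fun m : ℕ => (m : ℝ) ^ 2) atTop atTop :=
    (tendsto_pow_atTop two_ne_zero).comp tendsto_natCast_atTop_atTop
  have h2 := ((tendsto_rpow_neg_atTop hβ).comp h1).const_mul h₀
  rwa [mul_zero] at h2

lemma tendsto_mul_bandwidth {h₀ β : ℝ} (hh₀ : 0 < h₀) (hβ : β < 1 / 2) :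
    Tendsto (fun m : ℕ => m * bandwidth h₀ β m) atTop atTop := by
  have h1 : Tendsto (fun m : ℕ => (m : ℝ) ^ 2) atTop atTop :=
    (tendsto_pow_atTop two_ne_zero).comp tendsto_natCast_atTop_atTop
  have h2 := ((tendsto_rpow_atTop (show 0 < 1 / 2 - β by linarith)).comp h1).const_mul_atTop hh₀
  refine h2.congr' ?_
  filter_upwards [eventually_gt_atTop 0] with m hm
  have hm' : (0 : ℝ) < m := by exact_mod_cast hm
  rw [Function.comp_apply, sub_eq_add_neg, Real.rpow_add (by positivity), ← Real.sqrt_eq_rpow,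
    Real.sqrt_sq hm'.le, bandwidth]
  ring

/-! ### Expected normal scores -/

/-- The normal score `Φ(√(n h²) μ̂(x_i))` of the design point `x_i`, computed from the data `y`. -/
noncomputable def normalScore (K₀ : ℝ → ℝ) (h : ℝ) (m : ℕ) (y : ℕ × ℕ → ℝ) (i : ℕ × ℕ) : ℝ :=
  stdNormalCDF (√((m : ℝ) ^ 2 * h ^ 2) * kernelEstimate K₀ h m y (designPoint m i))

lemma normalScore_nonneg (K₀ : ℝ → ℝ) (h : ℝ) (m : ℕ) (y : ℕ × ℕ → ℝ) (i : ℕ × ℕ) :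
    0 ≤ normalScore K₀ h m y i := stdNormalCDF_nonneg _

lemma normalScore_le_one (K₀ : ℝ → ℝ) (h : ℝ) (m : ℕ) (y : ℕ × ℕ → ℝ) (i : ℕ × ℕ) :
    normalScore K₀ h m y i ≤ 1 := stdNormalCDF_le_one _

section Scores

variable {Ω : Type*} [MeasurableSpace Ω] {P : Measure Ω} {μ : ℝ × ℝ → ℝ} {K₀ : ℝ → ℝ} {L₀ : ℝ}
  {h : ℕ → ℝ} {ν : Measure ℝ} {ε : ℕ → ℕ × ℕ → Ω → ℝ}

lemma normalScore_response (K₀ : ℝ → ℝ) {h : ℝ} (hh : 0 < h) (μ : ℝ × ℝ → ℝ) (m : ℕ)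
    (e : ℕ × ℕ → ℝ) (i : ℕ × ℕ) :
    normalScore K₀ h m (response μ m e) i =
      stdNormalCDF (∑ j : gridIndex m, kernelWeight K₀ h m (designPoint m i) j *
          μ (designPoint m j) +
        ∑ j : gridIndex m, kernelWeight K₀ h m (designPoint m i) j * e j) := by
  rw [normalScore, sqrt_mul_kernelEstimate hh, ← Finset.sum_add_distrib]
  simp only [response, mul_add]

lemma eventually_pos_of_tendsto_mul (hmh : Tendsto (fun m : ℕ => m * h m) atTop atTop) :
    ∀ᶠ m in atTop, 0 < h m := by
  filter_upwards [hmh.eventually_gt_atTop 0] with m hm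
  exact pos_of_mul_pos_right hm (Nat.cast_nonneg m)

lemma eventually_forall_dist_lt (hh : Tendsto h atTop (𝓝 0)) {x : ℝ × ℝ}
    (hx : x ∈ halfOpenSquare) (L : ℝ) {r : ℝ} (hr : 0 < r) :
    ∀ᶠ m in atTop, ∀ z, dist z (designPoint m (cellIndex m x)) < L * h m → dist z x < r := by
  have h1 := (tendsto_iff_dist_tendsto_zero.1 (tendsto_designPoint_cellIndex hx)).eventually
    (gt_mem_nhds (half_pos hr))
  have h2 := (show Tendsto (fun m => L * h m) atTop (𝓝 0) by simpa using hh.const_mul L).eventually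
    (gt_mem_nhds (half_pos hr))
  filter_upwards [h1, h2] with m hm1 hm2 z hz
  linarith [dist_triangle z (designPoint m (cellIndex m x)) x]

/-- Inside the baseline region the expected normal score tends to `1 / 2`. -/
lemma tendsto_integral_normalScore_half (hK : IsSmoothingKernel K₀ L₀)
    (hh : Tendsto h atTop (𝓝 0)) (hmh : Tendsto (fun m : ℕ => m * h m) atTop atTop)
    (hν : MemLp (fun t : ℝ => t) 2 ν) (hν0 : ∫ t, t ∂ν = 0)
    (hlaw : ∀ m, ∀ i ∈ gridIndex m, HasLaw (ε m i) ν P)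
    (hind : ∀ m, iIndepFun (fun i : gridIndex m => ε m i) P) {x : ℝ × ℝ}
    (hx : x ∈ halfOpenSquare) (hx0 : x ∈ interior (baselineSet μ)) :
    Tendsto (fun m => ∫ ω, normalScore K₀ (h m) m (response μ m fun i => ε m i ω)
      (cellIndex m x) ∂P) atTop (𝓝 (1 / 2)) := by
  obtain ⟨C, hC0, hC⟩ := hK.exists_productKernel_le
  obtain ⟨r, hr, hball⟩ := Metric.mem_nhds_iff.1 (mem_interior_iff_mem_nhds.1 hx0)
  have hδ : Tendsto (fun m : ℕ => C / (m * h m)) atTop (𝓝[≥] 0) := by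
    refine tendsto_nhdsWithin_iff.2 ⟨hmh.const_div_atTop C, ?_⟩
    filter_upwards [hmh.eventually_gt_atTop 0] with m hm
    exact (div_pos hC0 hm).le
  have hlim := ((tendsto_integral_sq_mul_min hν).comp hδ).const_mul ((C * (2 * L₀ + 1)) ^ 2)
  rw [mul_zero] at hlim
  rw [tendsto_iff_dist_tendsto_zero]
  refine squeeze_zero' (Eventually.of_forall fun _ => dist_nonneg) ?_ hlim
  filter_upwards [eventually_pos_of_tendsto_mul hmh, hmh.eventually_ge_atTop 1,
    eventually_forall_dist_lt hh hx L₀ hr] with m hm0 hm1 hmw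
  -- For large m the whole window lies in the baseline region, so the signal is exactly zero and
  -- there is no bias to control.
  have hzero : ∑ j : gridIndex m, kernelWeight K₀ (h m) m (designPoint m (cellIndex m x)) j *
      μ (designPoint m j) = 0 := by
    refine Finset.sum_eq_zero fun j _ => ?_
    by_contra hne
    have := hball (Metric.mem_ball.2
      (hmw _ (hK.dist_lt_of_kernelWeight_ne_zero hm0 (left_ne_zero_of_mul hne))))
    exact right_ne_zero_of_mul hne this.2
  simp only [normalScore_response K₀ hm0, hzero, zero_add, Real.dist_eq]
  exact abs_integral_stdNormalCDF_weighted_sub_half_le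
    (ε := fun i : gridIndex m => ε m i)
    (a := fun j : gridIndex m => kernelWeight K₀ (h m) m (designPoint m (cellIndex m x)) j)
    hν hν0 (fun i => hlaw m i i.2) (hind m) (by positivity) (fun j => abs_kernelWeight_le hK hC hm0 m _ j)
    (sum_kernelWeight_sq_le hK hC hm0 hm1 _)

lemma eventually_designPoint_mem_margin (hh : Tendsto h atTop (𝓝 0)) {x : ℝ × ℝ}
    (hx : x ∈ interior unitSquare) (R : ℝ) :
    ∀ᶠ m : ℕ in atTop, designPoint m (cellIndex m x) ∈
      Icc (R * h m + 1 / m) (1 - R * h m) ×ˢ Icc (R * h m + 1 / m) (1 - R * h m) := by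
  rw [unitSquare, interior_prod_eq, interior_Icc] at hx
  have hx' : x ∈ halfOpenSquare := prod_mono Ioo_subset_Ioc_self Ioo_subset_Ioc_self hx
  have hd := tendsto_designPoint_cellIndex hx'
  have h0 : Tendsto (fun m : ℕ => R * h m) atTop (𝓝 0) := by simpa using hh.const_mul R
  have h1 : Tendsto (fun m : ℕ => R * h m + 1 / m) atTop (𝓝 0) := by
    simpa using h0.add (tendsto_one_div_atTop_nhds_zero_nat (𝕜 := ℝ))
  have h2 : Tendsto (fun m : ℕ => 1 - R * h m) atTop (𝓝 1) := by
    simpa using tendsto_const_nhds.sub h0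
  have hd1 := (continuous_fst.tendsto x).comp hd
  have hd2 := (continuous_snd.tendsto x).comp hd
  filter_upwards [h1.eventually_lt hd1 hx.1.1, hd1.eventually_lt h2 hx.1.2,
    h1.eventually_lt hd2 hx.2.1, hd2.eventually_lt h2 hx.2.2] with m a b c d
  exact ⟨⟨a.le, b.le⟩, ⟨c.le, d.le⟩⟩

/-- Outside the baseline region the expected normal score tends to `1`. -/
lemma tendsto_integral_normalScore_one (hμ : ContinuousOn μ unitSquare)
    (hK : IsSmoothingKernel K₀ L₀)
    (hh : Tendsto h atTop (𝓝 0)) (hmh : Tendsto (fun m : ℕ => m * h m) atTop atTop)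
    (hν : MemLp (fun t : ℝ => t) 2 ν) (hν0 : ∫ t, t ∂ν = 0)
    (hlaw : ∀ m, ∀ i ∈ gridIndex m, HasLaw (ε m i) ν P)
    (hind : ∀ m, iIndepFun (fun i : gridIndex m => ε m i) P) {x : ℝ × ℝ}
    (hx : x ∈ interior unitSquare) (hx0 : 0 < μ x) :
    Tendsto (fun m => ∫ ω, normalScore K₀ (h m) m (response μ m fun i => ε m i ω)
      (cellIndex m x) ∂P) atTop (𝓝 1) := by
  obtain ⟨C, hC0, hC⟩ := hK.exists_productKernel_le
  obtain ⟨c, hc, R, hR, hsig⟩ := exists_le_sum_kernelWeight_mul hK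
  have hx' : x ∈ halfOpenSquare := by
    rw [unitSquare, interior_prod_eq, interior_Icc] at hx
    exact prod_mono Ioo_subset_Ioc_self Ioo_subset_Ioc_self hx
  have hη := (hμ.continuousAt (mem_interior_iff_mem_nhds.1 hx)).eventually
    (lt_mem_nhds (half_lt_self hx0))
  obtain ⟨r, hr, hball⟩ := Metric.mem_nhds_iff.1 hη
  have hB : Tendsto (fun m : ℕ => μ x / 2 * (c * (m * h m))) atTop atTop :=
    (hmh.const_mul_atTop hc).const_mul_atTop (half_pos hx0)
  have hlim : Tendsto (fun m : ℕ => (1 - stdNormalCDF (μ x / 2 * (c * (m * h m)) / 2)) +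
      4 * ((C * (2 * L₀ + 1)) ^ 2 * ∫ t, t ^ 2 ∂ν) / (μ x / 2 * (c * (m * h m))) ^ 2)
      atTop (𝓝 0) := by
    have h1 := tendsto_const_nhds (x := (1 : ℝ)).sub
      (tendsto_stdNormalCDF_atTop.comp (hB.atTop_div_const two_pos))
    have h2 := ((tendsto_pow_atTop two_ne_zero).comp hB).const_div_atTop
      (4 * ((C * (2 * L₀ + 1)) ^ 2 * ∫ t, t ^ 2 ∂ν))
    simpa using h1.add h2
  rw [tendsto_iff_dist_tendsto_zero]
  refine squeeze_zero' (Eventually.of_forall fun _ => dist_nonneg) ?_ hlim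
  filter_upwards [eventually_pos_of_tendsto_mul hmh, hmh.eventually_ge_atTop 1,
    hmh.eventually_ge_atTop R, hB.eventually_gt_atTop 0, eventually_designPoint_mem_margin hh hx R,
    eventually_forall_dist_lt hh hx' L₀ hr] with m hm0 hm1 hmR hmB hmx hmw
  have hsig' := hsig (h m) m (designPoint m (cellIndex m x)) μ (μ x / 2) hm0 hmR hmx
    (half_pos hx0).le fun z _ hz => le_of_lt (hball (Metric.mem_ball.2 (hmw z hz)))
  simp only [normalScore_response K₀ hm0, Real.dist_eq]
  exact abs_integral_stdNormalCDF_add_weighted_sub_one_le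
    (ε := fun i : gridIndex m => ε m i)
    (a := fun j : gridIndex m => kernelWeight K₀ (h m) m (designPoint m (cellIndex m x)) j)
    hν hν0 (fun i => hlaw m i i.2) (hind m)
    (sum_kernelWeight_sq_le hK hC hm0 hm1 _) hmB hsig'

end Scores

/-! ### Riemann sums over the design -/

lemma measurable_cellIndex (m : ℕ) : Measurable (cellIndex m) :=
  (Nat.measurable_ceil.comp (measurable_fst.const_mul (m : ℝ))).prodMk
    (Nat.measurable_ceil.comp (measurable_snd.const_mul (m : ℝ)))

lemma measurableSet_halfOpenSquare : MeasurableSet halfOpenSquare :=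
  measurableSet_Ioc.prod measurableSet_Ioc

lemma volume_real_prod (s t : Set ℝ) :
    volume.real (s ×ˢ t) = volume.real s * volume.real t := by
  rw [Measure.volume_eq_prod, measureReal_prod_prod]

instance isFiniteMeasure_restrict_halfOpenSquare :
    IsFiniteMeasure (volume.restrict halfOpenSquare) := by
  refine ⟨?_⟩
  rw [Measure.restrict_apply_univ, halfOpenSquare, Measure.volume_eq_prod, Measure.prod_prod]
  simp

/-- The half-open cell of mesh `1 / q` whose upper right corner is `(i.1 / q, i.2 / q)`. -/
def gridCell (q : ℕ) (i : ℕ × ℕ) : Set (ℝ × ℝ) :=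
  Ioc (((i.1 : ℝ) - 1) / q) (i.1 / q) ×ˢ Ioc (((i.2 : ℝ) - 1) / q) (i.2 / q)

/-- Cells are the fibers of `cellIndex`; being half-open, they partition the half-open square
without overlaps. -/
lemma mem_gridCell_iff {q : ℕ} (hq : 0 < q) {i : ℕ × ℕ} (hi : i ∈ gridIndex q) {x : ℝ × ℝ} :
    x ∈ gridCell q i ↔ x ∈ halfOpenSquare ∧ cellIndex q x = i := by
  have hq' : (0 : ℝ) < q := by exact_mod_cast hq
  rw [gridIndex, Finset.mem_product, Finset.mem_Icc, Finset.mem_Icc] at hi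
  have key : ∀ (k : ℕ), 1 ≤ k ∧ k ≤ q → ∀ t : ℝ, (t ∈ Ioc (0 : ℝ) 1 ∧ ⌈q * t⌉₊ = k) ↔
      t ∈ Ioc (((k : ℝ) - 1) / q) (k / q) := by
    intro k hk t
    have h1 : (1 : ℝ) ≤ k := by exact_mod_cast hk.1
    have h2 : (k : ℝ) ≤ q := by exact_mod_cast hk.2
    rw [Nat.ceil_eq_iff (by omega), Nat.cast_sub hk.1, Nat.cast_one, mem_Ioc, mem_Ioc,
      div_lt_iff₀ hq', le_div_iff₀ hq', mul_comm t]
    refine ⟨fun h => h.2, fun h => ⟨⟨?_, ?_⟩, h⟩⟩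
    · exact pos_of_mul_pos_right (show 0 < q * t by linarith [h.1]) hq'.le
    · exact le_of_mul_le_mul_left (by linarith [h.2]) hq'
  rw [gridCell, mem_prod, ← key i.1 hi.1, ← key i.2 hi.2]
  simp only [halfOpenSquare, mem_prod, cellIndex, Prod.ext_iff]
  tauto

lemma measurableSet_gridCell (q : ℕ) (i : ℕ × ℕ) : MeasurableSet (gridCell q i) :=
  measurableSet_Ioc.prod measurableSet_Ioc

lemma volume_real_gridCell (q : ℕ) (i : ℕ × ℕ) :
    volume.real (gridCell q i) = 1 / (q : ℝ) ^ 2 := by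
  have hlen : ∀ k : ℕ, volume.real (Ioc (((k : ℝ) - 1) / q) (k / q)) = 1 / q := by
    intro k
    rw [Real.volume_real_Ioc_of_le (by gcongr; linarith)]
    ring
  rw [gridCell, volume_real_prod, hlen, hlen]
  ring

lemma pairwiseDisjoint_gridCell {q : ℕ} (hq : 0 < q) :
    (gridIndex q : Set (ℕ × ℕ)).PairwiseDisjoint (gridCell q) := by
  intro i hi j hj hij
  refine Set.disjoint_left.2 fun x hx hx' => hij ?_
  rw [← ((mem_gridCell_iff hq hi).1 hx).2, ← ((mem_gridCell_iff hq hj).1 hx').2]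

/-- An average over the design is the integral of a step function. -/
lemma setIntegral_comp_cellIndex {m : ℕ} (hm : 0 < m) (F : ℕ × ℕ → ℝ) :
    ∫ x in halfOpenSquare, F (cellIndex m x) = 1 / (m : ℝ) ^ 2 * ∑ i ∈ gridIndex m, F i := by
  have e : halfOpenSquare = ⋃ i ∈ gridIndex m, gridCell m i := by
    ext x
    simp only [mem_iUnion, exists_prop]
    refine ⟨fun hx => ⟨_, cellIndex_mem_gridIndex hm hx, ?_⟩, fun ⟨_, hi, hx⟩ =>
      ((mem_gridCell_iff hm hi).1 hx).1⟩
    exact (mem_gridCell_iff hm (cellIndex_mem_gridIndex hm hx)).2 ⟨hx, rfl⟩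
  have hint : ∀ i ∈ gridIndex m, EqOn (fun x => F (cellIndex m x)) (fun _ => F i)
      (gridCell m i) := by
    intro i hi x hx
    simp only [((mem_gridCell_iff hm hi).1 hx).2]
  conv_lhs => rw [e]
  rw [integral_biUnion_finset _ (fun i _ => measurableSet_gridCell m i)
    (pairwiseDisjoint_gridCell hm), Finset.mul_sum]
  · refine Finset.sum_congr rfl fun i hi => ?_
    rw [setIntegral_congr_fun (measurableSet_gridCell m i) (hint i hi), setIntegral_const,
      volume_real_gridCell, smul_eq_mul]
  · intro i hi
    refine IntegrableOn.congr_fun (f := fun _ => F i) ?_ (fun x hx => (hint i hi hx).symm)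
      (measurableSet_gridCell m i)
    refine integrableOn_const (ne_top_of_le_ne_top ?_ (measure_mono fun x hx =>
      ((mem_gridCell_iff hm hi).1 hx).1))
    simpa using measure_ne_top (volume.restrict halfOpenSquare) univ

lemma ae_notMem_frontier {c : Set (ℝ × ℝ)} (hc : Convex ℝ c) :
    ∀ᵐ x ∂(volume : Measure (ℝ × ℝ)), x ∉ frontier c :=
  measure_eq_zero_iff_ae_notMem.1 (hc.addHaar_frontier volume)

/-! ### Mean, variance and pointwise convergence of the criterion -/

section Criterion

variable {Ω : Type*} [MeasurableSpace Ω] {P : Measure Ω} {μ : ℝ × ℝ → ℝ} {K₀ : ℝ → ℝ} {L₀ : ℝ}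
  {h : ℕ → ℝ} {ν : Measure ℝ} {ε : ℕ → ℕ × ℕ → Ω → ℝ} {γ : ℝ}

open Classical in
lemma empiricalCriterion_eq_sum (K₀ : ℝ → ℝ) (L₀ h γ : ℝ) (m : ℕ) (y : ℕ × ℕ → ℝ)
    (S : Set (ℝ × ℝ)) :
    empiricalCriterion K₀ L₀ h γ m y S = 1 / (m : ℝ) ^ 2 *
      ∑ i ∈ gridIndex m with designPoint m i ∈ innerSquare L₀ h ∩ S,
        (normalScore K₀ h m y i - γ) := by
  rw [empiricalCriterion]
  congr 1
  simp only [mem_inter_iff, Set.indicator_apply, mul_ite, mul_one, mul_zero]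
  rw [← Finset.sum_filter, Finset.filter_filter]
  rfl

lemma aemeasurable_normalScore [IsProbabilityMeasure P] {m : ℕ} {h : ℝ} (hh : 0 < h)
    (hlaw : ∀ i ∈ gridIndex m, HasLaw (ε m i) ν P) (i : ℕ × ℕ) :
    AEMeasurable (fun ω => normalScore K₀ h m (response μ m fun i => ε m i ω) i) P := by
  simp only [normalScore_response K₀ hh]
  refine continuous_stdNormalCDF.measurable.comp_aemeasurable (aemeasurable_const.add ?_)
  exact Finset.aemeasurable_fun_sum _ fun j _ => (hlaw j j.2).aemeasurable.const_mul _

lemma memLp_normalScore [IsProbabilityMeasure P] {m : ℕ} {h : ℝ} (hh : 0 < h)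
    (hlaw : ∀ i ∈ gridIndex m, HasLaw (ε m i) ν P) (i : ℕ × ℕ) :
    MemLp (fun ω => normalScore K₀ h m (response μ m fun i => ε m i ω) i) 2 P := by
  refine MemLp.of_bound (aemeasurable_normalScore hh hlaw i).aestronglyMeasurable 1
    (ae_of_all _ fun ω => ?_)
  rw [Real.norm_eq_abs, abs_of_nonneg (normalScore_nonneg _ _ _ _ _)]
  exact normalScore_le_one _ _ _ _ _

/-- The expected criterion of a convex set converges to its limiting criterion. -/
lemma tendsto_integral_empiricalCriterion [IsProbabilityMeasure P]
    (hμ : ContinuousOn μ unitSquare) (hμ0 : ∀ x ∈ unitSquare, 0 ≤ μ x)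
    (hK : IsSmoothingKernel K₀ L₀)
    (hh : Tendsto h atTop (𝓝 0)) (hmh : Tendsto (fun m : ℕ => m * h m) atTop atTop)
    (hν : MemLp (fun t : ℝ => t) 2 ν) (hν0 : ∫ t, t ∂ν = 0)
    (hlaw : ∀ m, ∀ i ∈ gridIndex m, HasLaw (ε m i) ν P)
    (hind : ∀ m, iIndepFun (fun i : gridIndex m => ε m i) P) (hγ : γ ∈ Icc (0 : ℝ) 1)
    (hS₀ : Convex ℝ (baselineSet μ)) (hS₀m : MeasurableSet (baselineSet μ))
    {c : Set (ℝ × ℝ)} (hc : Convex ℝ c) (hcm : MeasurableSet c) (hcs : c ⊆ halfOpenSquare) :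
    Tendsto (fun m => ∫ ω, empiricalCriterion K₀ L₀ (h m) γ m (response μ m fun i => ε m i ω) c ∂P)
      atTop (𝓝 (limitCriterion γ (baselineSet μ) c)) := by
  classical
  set E : ℕ → ℕ × ℕ → ℝ := fun m i =>
    ∫ ω, normalScore K₀ (h m) m (response μ m fun i => ε m i ω) i ∂P with hE
  have hE01 : ∀ m i, E m i ∈ Icc (0 : ℝ) 1 := by
    intro m i
    refine ⟨integral_nonneg fun ω => normalScore_nonneg _ _ _ _ _, ?_⟩
    have := norm_integral_le_of_norm_le_const (μ := P) (C := 1)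
      (f := fun ω => normalScore K₀ (h m) m (response μ m fun i => ε m i ω) i)
      (ae_of_all _ fun ω => by
        rw [Real.norm_eq_abs, abs_of_nonneg (normalScore_nonneg _ _ _ _ _)]
        exact normalScore_le_one _ _ _ _ _)
    simp only [probReal_univ, mul_one] at this
    exact (le_abs_self _).trans this
  -- The expected criterion is the integral of the step function x ↦ F m (cellIndex m x), so a
  -- pointwise limit and domination by 1 suffice.
  set F : ℕ → ℕ × ℕ → ℝ := fun m i =>
    if designPoint m i ∈ innerSquare L₀ (h m) ∩ c then E m i - γ else 0 with hF
  have hF1 : ∀ m i, |F m i| ≤ 1 := by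
    intro m i
    simp only [hF]
    split_ifs
    · have := hE01 m i
      rw [abs_le]
      constructor <;> linarith [this.1, this.2, hγ.1, hγ.2]
    · simp
  set g : ℝ × ℝ → ℝ := fun x => (1 / 2 - γ) * (baselineSet μ ∩ c).indicator (fun _ => 1) x +
    (1 - γ) * ((baselineSet μ)ᶜ ∩ c).indicator (fun _ => 1) x with hg
  have hgint : ∫ x in halfOpenSquare, g x = limitCriterion γ (baselineSet μ) c := by
    have hi : ∀ s : Set (ℝ × ℝ), MeasurableSet s → s ⊆ halfOpenSquare →
        Integrable (s.indicator fun _ => (1 : ℝ)) (volume.restrict halfOpenSquare) ∧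
        ∫ x in halfOpenSquare, s.indicator (fun _ => (1 : ℝ)) x = volume.real s := by
      intro s hs hsub
      refine ⟨(integrable_const 1).indicator hs, ?_⟩
      rw [integral_indicator hs, setIntegral_const, smul_eq_mul, mul_one,
        measureReal_restrict_apply hs, inter_eq_left.2 hsub]
    obtain ⟨i1, v1⟩ := hi _ (hS₀m.inter hcm) (inter_subset_right.trans hcs)
    obtain ⟨i2, v2⟩ := hi _ (hS₀m.compl.inter hcm) (inter_subset_right.trans hcs)
    rw [hg, integral_add (i1.const_mul _) (i2.const_mul _), integral_const_mul,
      integral_const_mul, v1, v2, limitCriterion]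
  -- Three null frontiers are discarded: that of c, so that membership of the design point
  -- stabilizes; that of S₀, so that x is interior or μ x > 0; that of the unit square, so that the
  -- inner square eventually contains the design point.
  have hconv : ∀ᵐ x ∂(volume.restrict halfOpenSquare),
      Tendsto (fun m => F m (cellIndex m x)) atTop (𝓝 (g x)) := by
    filter_upwards [ae_restrict_mem measurableSet_halfOpenSquare,
      ae_restrict_of_ae (ae_notMem_frontier hc), ae_restrict_of_ae (ae_notMem_frontier hS₀),
      ae_restrict_of_ae (ae_notMem_frontier (c := unitSquare)
        ((convex_Icc (0 : ℝ) 1).prod (convex_Icc 0 1)))] with x hx hxc hxS hxU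
    have hxU' : x ∈ interior unitSquare := by
      by_contra hn
      exact hxU ⟨subset_closure (halfOpenSquare_subset_unitSquare hx), hn⟩
    have hd := tendsto_designPoint_cellIndex hx
    by_cases hxc' : x ∈ c
    · have hxi : x ∈ interior c := by
        by_contra hn
        exact hxc ⟨subset_closure hxc', hn⟩
      have hF' : ∀ᶠ m in atTop, E m (cellIndex m x) - γ = F m (cellIndex m x) := by
        filter_upwards [hd.eventually (mem_interior_iff_mem_nhds.1 hxi),
          eventually_designPoint_mem_margin hh hxU' L₀] with m hm1 hm2
        have hm3 : designPoint m (cellIndex m x) ∈ innerSquare L₀ (h m) := by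
          have h0 : L₀ * h m ≤ L₀ * h m + 1 / m := by
            have : (0 : ℝ) ≤ 1 / m := by positivity
            linarith
          exact prod_mono (Icc_subset_Icc_left h0) (Icc_subset_Icc_left h0) hm2
        have hm4 : designPoint m (cellIndex m x) ∈ innerSquare L₀ (h m) ∩ c := ⟨hm3, hm1⟩
        simp only [hF, if_pos hm4]
      refine Tendsto.congr' hF' ?_
      by_cases hxS' : x ∈ baselineSet μ
      · have hxi : x ∈ interior (baselineSet μ) := by
          by_contra hn
          exact hxS ⟨subset_closure hxS', hn⟩
        have := (tendsto_integral_normalScore_half hK hh hmh hν hν0 hlaw hind hx hxi).sub_const γ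
        simpa [hg, hxc', hxS'] using this
      · have hpos : 0 < μ x := by
          have hxu := halfOpenSquare_subset_unitSquare hx
          exact lt_of_le_of_ne (hμ0 x hxu) fun h0 => hxS' ⟨hxu, h0.symm⟩
        have := (tendsto_integral_normalScore_one hμ hK hh hmh hν hν0 hlaw hind hxU' hpos).sub_const
          γ
        simpa [hg, hxc', hxS'] using this
    · have hxi : x ∈ (closure c)ᶜ := fun hcl => hxc ⟨hcl, fun hi => hxc' (interior_subset hi)⟩
      have hg0 : g x = 0 := by simp [hg, hxc']
      rw [hg0]
      refine tendsto_const_nhds.congr' ?_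
      filter_upwards [hd.eventually (isClosed_closure.isOpen_compl.mem_nhds hxi)] with m hm
      simp only [hF]
      rw [if_neg fun hmem => hm (subset_closure hmem.2)]
  have hDCT : Tendsto (fun m => ∫ x in halfOpenSquare, F m (cellIndex m x)) atTop
      (𝓝 (∫ x in halfOpenSquare, g x)) := by
    refine tendsto_integral_of_dominated_convergence (fun _ => 1) (fun m => ?_)
      (integrable_const 1) (fun m => ae_of_all _ fun x => hF1 m _) hconv
    exact ((measurable_of_countable (F m)).comp (measurable_cellIndex m)).aestronglyMeasurable
  rw [hgint] at hDCT
  refine hDCT.congr' ?_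
  filter_upwards [eventually_gt_atTop 0, eventually_pos_of_tendsto_mul hmh] with m hm hm0
  rw [setIntegral_comp_cellIndex hm]
  simp only [empiricalCriterion_eq_sum]
  have hi : ∀ i, Integrable
      (fun ω => normalScore K₀ (h m) m (response μ m fun i => ε m i ω) i) P :=
    fun i => (memLp_normalScore hm0 (hlaw m) i).integrable one_le_two
  have hi' : ∀ i, Integrable
      (fun ω => normalScore K₀ (h m) m (response μ m fun i => ε m i ω) i - γ) P :=
    fun i => (hi i).sub (integrable_const γ)
  rw [integral_const_mul, integral_finsetSum _ fun i _ => hi' i,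
    Finset.sum_filter]
  congr 1
  refine Finset.sum_congr rfl fun i _ => ?_
  simp only [hF]
  split_ifs
  · rw [integral_sub (hi i) (integrable_const γ)]
    simp [hE]
  · rfl

/-- Normal scores of points whose windows are disjoint are independent. -/
lemma indepFun_normalScore (hK : IsSmoothingKernel K₀ L₀) {m : ℕ} {h : ℝ} (hh : 0 < h)
    (hlaw : ∀ i ∈ gridIndex m, HasLaw (ε m i) ν P)
    (hind : iIndepFun (fun i : gridIndex m => ε m i) P) {i j : ℕ × ℕ}
    (hij : 2 * (L₀ * h) ≤ dist (designPoint m i) (designPoint m j)) :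
    IndepFun (fun ω => normalScore K₀ h m (response μ m fun i => ε m i ω) i)
      (fun ω => normalScore K₀ h m (response μ m fun i => ε m i ω) j) P := by
  classical
  set W : ℕ × ℕ → Finset (gridIndex m) := fun i =>
    Finset.univ.filter fun k => kernelWeight K₀ h m (designPoint m i) k ≠ 0 with hW
  have hdisj : Disjoint (W i) (W j) := by
    refine Finset.disjoint_left.2 fun k hk hk' => ?_
    have h1 := hK.dist_lt_of_kernelWeight_ne_zero hh (Finset.mem_filter.1 hk).2
    have h2 := hK.dist_lt_of_kernelWeight_ne_zero hh (Finset.mem_filter.1 hk').2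
    rw [dist_comm] at h1
    linarith [dist_triangle (designPoint m i) (designPoint m k) (designPoint m j)]
  have hI := hind.indepFun_finset₀ (W i) (W j) hdisj fun k => (hlaw k k.2).aemeasurable
  set φ : ∀ i, (W i → ℝ) → ℝ := fun i e =>
    stdNormalCDF (∑ k : gridIndex m, kernelWeight K₀ h m (designPoint m i) k *
      μ (designPoint m k) + ∑ k : W i, kernelWeight K₀ h m (designPoint m i) k * e k) with hφ
  have hφm : ∀ i, Measurable (φ i) := fun i =>
    continuous_stdNormalCDF.measurable.comp (by fun_prop)
  have e : ∀ i, (fun ω => normalScore K₀ h m (response μ m fun i => ε m i ω) i) =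
      φ i ∘ fun ω (k : W i) => ε m k ω := by
    intro i
    funext ω
    simp only [normalScore_response K₀ hh, hφ, Function.comp]
    congr 2
    rw [Finset.sum_coe_sort (W i) fun k => kernelWeight K₀ h m (designPoint m i) k * ε m k ω, hW,
      Finset.sum_filter]
    refine Finset.sum_congr rfl fun k _ => ?_
    split_ifs with h0
    · rfl
    · rw [not_not.1 h0, zero_mul]
  rw [e i, e j]
  exact hI.comp (hφm i) (hφm j)

lemma abs_covariance_le_two [IsProbabilityMeasure P] {X Y : Ω → ℝ} (hX : MemLp X 2 P)
    (hY : MemLp Y 2 P) (hX1 : ∀ ω, |X ω| ≤ 1) (hY1 : ∀ ω, |Y ω| ≤ 1) : |cov[X, Y; P]| ≤ 2 := by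
  have key : ∀ Z : Ω → ℝ, (∀ ω, |Z ω| ≤ 1) → |∫ ω, Z ω ∂P| ≤ 1 := by
    intro Z hZ
    simpa using norm_integral_le_of_norm_le_const (μ := P) (C := 1) (f := Z) (ae_of_all _ hZ)
  rw [covariance_eq_sub hX hY]
  have h1 := key X hX1
  have h2 := key Y hY1
  have h3 := key (X * Y) fun ω => by
    rw [Pi.mul_apply, abs_mul]
    exact mul_le_one₀ (hX1 ω) (abs_nonneg _) (hY1 ω)
  have h4 : |(∫ ω, X ω ∂P) * ∫ ω, Y ω ∂P| ≤ 1 := by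
    rw [abs_mul]
    exact mul_le_one₀ h1 (abs_nonneg _) h2
  rw [abs_le] at h3 h4 ⊢
  constructor <;> linarith [h3.1, h3.2, h4.1, h4.2]

lemma memLp_empiricalCriterion [IsProbabilityMeasure P] {m : ℕ} {h : ℝ} (hh : 0 < h)
    (hlaw : ∀ i ∈ gridIndex m, HasLaw (ε m i) ν P) (S : Set (ℝ × ℝ)) :
    MemLp (fun ω => empiricalCriterion K₀ L₀ h γ m (response μ m fun i => ε m i ω) S) 2 P := by
  simp only [empiricalCriterion_eq_sum]
  exact (memLp_finsetSum _ fun i _ =>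
    (memLp_normalScore hh hlaw i).sub (memLp_const γ)).const_mul _

/-- Only points within sup distance 2 L₀ h are correlated. Each point has at most (4 L₀ h m + 1)²
such neighbours, with covariance at most 2, against the normalization m⁻⁴ for m² points. -/
lemma variance_empiricalCriterion_le [IsProbabilityMeasure P] (hK : IsSmoothingKernel K₀ L₀)
    {m : ℕ} (hm : 0 < m) {h : ℝ} (hh : 0 < h) (hlaw : ∀ i ∈ gridIndex m, HasLaw (ε m i) ν P)
    (hind : iIndepFun (fun i : gridIndex m => ε m i) P) (hγ : γ ∈ Icc (0 : ℝ) 1)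
    (S : Set (ℝ × ℝ)) :
    Var[fun ω => empiricalCriterion K₀ L₀ h γ m (response μ m fun i => ε m i ω) S; P] ≤
      2 * (4 * L₀ * h + 1 / m) ^ 2 := by
  classical
  have hL := hK.radius_pos
  have hm' : (0 : ℝ) < m := by exact_mod_cast hm
  set X : ℕ × ℕ → Ω → ℝ := fun i ω =>
    normalScore K₀ h m (response μ m fun i => ε m i ω) i - γ with hX
  have hX2 : ∀ i, MemLp (X i) 2 P := fun i => (memLp_normalScore hh hlaw i).sub (memLp_const γ)
  have hX1 : ∀ i ω, |X i ω| ≤ 1 := by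
    intro i ω
    have h1 := normalScore_nonneg K₀ h m (response μ m fun i => ε m i ω) i
    have h2 := normalScore_le_one K₀ h m (response μ m fun i => ε m i ω) i
    rw [abs_le]
    constructor <;> simp only [hX] <;> linarith [hγ.1, hγ.2]
  have hcov : ∀ i j, cov[X i, X j; P] ≤
      if designPoint m j ∈ Metric.closedBall (designPoint m i) (2 * (L₀ * h)) then 2 else 0 := by
    intro i j
    split_ifs with hij
    · exact (le_abs_self _).trans (abs_covariance_le_two (hX2 i) (hX2 j) (hX1 i) (hX1 j))
    · rw [Metric.mem_closedBall, not_le, dist_comm] at hij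
      have := (indepFun_normalScore (μ := μ) hK hh hlaw hind hij.le).comp
        (measurable_id.sub_const γ) (measurable_id.sub_const γ)
      exact (IndepFun.covariance_eq_zero this (hX2 i) (hX2 j)).le
  simp only [empiricalCriterion_eq_sum]
  set G := (gridIndex m).filter fun i => designPoint m i ∈ innerSquare L₀ h ∩ S
  have hGc : (G.card : ℝ) ≤ (m : ℝ) ^ 2 := by
    have := Finset.card_le_card (Finset.filter_subset (fun i =>
      designPoint m i ∈ innerSquare L₀ h ∩ S) (gridIndex m))
    rw [card_gridIndex] at this
    exact_mod_cast this
  rw [variance_const_mul, variance_fun_sum' fun i _ => hX2 i]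
  have hrow : ∀ i, ∑ j ∈ G, cov[X i, X j; P] ≤ 2 * (2 * (2 * (L₀ * h)) * m + 1) ^ 2 := by
    intro i
    calc _ ≤ ∑ j ∈ G, (if designPoint m j ∈ Metric.closedBall (designPoint m i) (2 * (L₀ * h))
            then (2 : ℝ) else 0) := Finset.sum_le_sum fun j _ => hcov i j
      _ ≤ ∑ j ∈ gridIndex m, (if designPoint m j ∈
            Metric.closedBall (designPoint m i) (2 * (L₀ * h)) then (2 : ℝ) else 0) :=
          Finset.sum_le_sum_of_subset_of_nonneg (Finset.filter_subset _ _)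
            fun j _ _ => by split_ifs <;> norm_num
      _ = 2 * (((gridIndex m).filter fun j => designPoint m j ∈
            Metric.closedBall (designPoint m i) (2 * (L₀ * h))).card : ℝ) := by
          rw [← Finset.sum_filter, Finset.sum_const, nsmul_eq_mul, mul_comm]
      _ ≤ _ := by
          gcongr
          exact card_filter_designPoint_mem_closedBall_le m _ (by positivity)
  calc _ ≤ (1 / (m : ℝ) ^ 2) ^ 2 * ∑ i ∈ G, 2 * (2 * (2 * (L₀ * h)) * m + 1) ^ 2 := by
        gcongr with i
        exact hrow i
    _ = (1 / (m : ℝ) ^ 2) ^ 2 * (G.card * (2 * (2 * (2 * (L₀ * h)) * m + 1) ^ 2)) := by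
        rw [Finset.sum_const, nsmul_eq_mul]
    _ ≤ (1 / (m : ℝ) ^ 2) ^ 2 * ((m : ℝ) ^ 2 * (2 * (2 * (2 * (L₀ * h)) * m + 1) ^ 2)) := by
        gcongr
    _ = _ := by
        field_simp
        ring

/-- The criterion of a fixed convex set converges in probability. -/
lemma tendsto_measure_abs_empiricalCriterion_sub [IsProbabilityMeasure P]
    (hμ : ContinuousOn μ unitSquare) (hμ0 : ∀ x ∈ unitSquare, 0 ≤ μ x)
    (hK : IsSmoothingKernel K₀ L₀)
    (hh : Tendsto h atTop (𝓝 0)) (hmh : Tendsto (fun m : ℕ => m * h m) atTop atTop)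
    (hν : MemLp (fun t : ℝ => t) 2 ν) (hν0 : ∫ t, t ∂ν = 0)
    (hlaw : ∀ m, ∀ i ∈ gridIndex m, HasLaw (ε m i) ν P)
    (hind : ∀ m, iIndepFun (fun i : gridIndex m => ε m i) P) (hγ : γ ∈ Icc (0 : ℝ) 1)
    (hS₀ : Convex ℝ (baselineSet μ)) (hS₀m : MeasurableSet (baselineSet μ))
    {c : Set (ℝ × ℝ)} (hc : Convex ℝ c) (hcm : MeasurableSet c) (hcs : c ⊆ halfOpenSquare)
    {δ : ℝ} (hδ : 0 < δ) :
    Tendsto (fun m => P {ω | δ ≤ |empiricalCriterion K₀ L₀ (h m) γ m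
      (response μ m fun i => ε m i ω) c - limitCriterion γ (baselineSet μ) c|})
      atTop (𝓝 0) := by
  have hmean := tendsto_integral_empiricalCriterion hμ hμ0 hK hh hmh hν hν0 hlaw hind hγ hS₀ hS₀m
    hc hcm hcs
  have hlim : Tendsto (fun m : ℕ => ENNReal.ofReal (2 * (4 * L₀ * h m + 1 / m) ^ 2 / (δ / 2) ^ 2))
      atTop (𝓝 0) := by
    have h1 := (((hh.const_mul (4 * L₀)).add
      (tendsto_one_div_atTop_nhds_zero_nat (𝕜 := ℝ))).pow 2).const_mul 2 |>.div_const ((δ / 2) ^ 2)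
    simpa using ENNReal.tendsto_ofReal h1
  refine tendsto_of_tendsto_of_tendsto_of_le_of_le' tendsto_const_nhds hlim
    (Eventually.of_forall fun _ => zero_le) ?_
  filter_upwards [eventually_gt_atTop 0, eventually_pos_of_tendsto_mul hmh,
    Metric.tendsto_nhds.1 hmean (δ / 2) (half_pos hδ)] with m hm hm0 hmd
  set X : Ω → ℝ := fun ω => empiricalCriterion K₀ L₀ (h m) γ m (response μ m fun i => ε m i ω) c
  have hX : MemLp X 2 P := memLp_empiricalCriterion hm0 (hlaw m) c
  -- The bias takes up at most δ/2; Chebyshev's inequality handles the other half.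
  calc _ ≤ P {ω | δ / 2 ≤ |X ω - ∫ ω, X ω ∂P|} := by
        refine measure_mono fun ω (hω : δ ≤ |X ω - _|) => ?_
        have := abs_sub_le (X ω) (∫ ω, X ω ∂P) (limitCriterion γ (baselineSet μ) c)
        rw [Real.dist_eq] at hmd
        rw [mem_ofPred_eq]
        linarith
    _ ≤ ENNReal.ofReal (Var[X; P] / (δ / 2) ^ 2) := meas_ge_le_variance_div_sq hX (half_pos hδ)
    _ ≤ _ := by
        gcongr
        exact variance_empiricalCriterion_le hK hm hm0 (hlaw m) (hind m) hγ c

end Criterion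

/-! ### Cells meeting the boundary of a convex set -/

lemma convex_gridCell (q : ℕ) (i : ℕ × ℕ) : Convex ℝ (gridCell q i) :=
  (convex_Ioc _ _).prod (convex_Ioc _ _)

lemma gridCell_subset_halfOpenSquare {q : ℕ} (hq : 0 < q) {i : ℕ × ℕ} (hi : i ∈ gridIndex q) :
    gridCell q i ⊆ halfOpenSquare := fun _ hx => ((mem_gridCell_iff hq hi).1 hx).1

lemma gridCell_subset_closedBall {q : ℕ} (i : ℕ × ℕ) :
    gridCell q i ⊆ Metric.closedBall (designPoint q i) (1 / q) := by
  intro x hx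
  have key : ∀ (k : ℕ) (t : ℝ), t ∈ Ioc (((k : ℝ) - 1) / q) (k / q) →
      dist t (k / q) ≤ 1 / q := by
    intro k t ht
    have h1 := ht.1
    rw [sub_div] at h1
    rw [Real.dist_eq, abs_le]
    have : (0 : ℝ) ≤ 1 / q := by positivity
    constructor <;> linarith [ht.2]
  rw [Metric.mem_closedBall, Prod.dist_eq]
  exact max_le (key _ _ hx.1) (key _ _ hx.2)

open Classical in
/-- The cells of mesh `1 / q` that meet `S` but are not contained in `S`. -/
noncomputable def boundaryCells (q : ℕ) (S : Set (ℝ × ℝ)) : Finset (ℕ × ℕ) :=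
  (gridIndex q).filter fun i => (S ∩ gridCell q i).Nonempty ∧ ¬ gridCell q i ⊆ S

/-- A point outside a closed convex set is the corner of a closed quadrant that misses the set. -/
lemma exists_quadrant_disjoint {S : Set (ℝ × ℝ)} (hS : IsClosed S) (hc : Convex ℝ S)
    {v : ℝ × ℝ} (hv : v ∉ S) :
    ∃ s ∈ ({1, -1} : Finset ℤ) ×ˢ ({1, -1} : Finset ℤ), ∀ w : ℝ × ℝ,
      0 ≤ (s.1 : ℝ) * (w.1 - v.1) → 0 ≤ (s.2 : ℝ) * (w.2 - v.2) → w ∉ S := by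
  obtain ⟨f, u, hf, hu⟩ := geometric_hahn_banach_closed_point hc hS hv
  have hlin : ∀ w : ℝ × ℝ, f w = w.1 * f (1, 0) + w.2 * f (0, 1) := by
    intro w
    have : w = w.1 • ((1, 0) : ℝ × ℝ) + w.2 • ((0, 1) : ℝ × ℝ) := by ext <;> simp
    conv_lhs => rw [this, map_add, map_smul, map_smul]
    rfl
  -- The signs of the coefficients of the separating functional select the quadrant at v on which
  -- the functional is at least its value at v.
  have hsign : ∀ a : ℝ, ∃ s ∈ ({1, -1} : Finset ℤ), ∀ t : ℝ, 0 ≤ (s : ℝ) * t → 0 ≤ t * a := by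
    intro a
    rcases le_total 0 a with ha | ha
    · refine ⟨1, by simp, fun t ht => mul_nonneg ?_ ha⟩
      simpa using ht
    · refine ⟨-1, by simp, fun t ht => mul_nonneg_of_nonpos_of_nonpos ?_ ha⟩
      simpa using ht
  obtain ⟨s₁, hs₁, h₁⟩ := hsign (f (1, 0))
  obtain ⟨s₂, hs₂, h₂⟩ := hsign (f (0, 1))
  refine ⟨(s₁, s₂), Finset.mem_product.2 ⟨hs₁, hs₂⟩, fun w hw1 hw2 hw => ?_⟩
  have a := h₁ _ hw1
  have b := h₂ _ hw2
  have c := hf w hw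
  rw [hlin] at c hu
  linarith

/-- A closed convex set has at most `O(q)` boundary cells among the `q²` cells of mesh `1 / q`:
for each of the four types of quadrants there is at most one on each diagonal. -/
lemma card_boundaryCells_le {q : ℕ} (hq : 0 < q) {S : Set (ℝ × ℝ)} (hS : IsClosed S)
    (hc : Convex ℝ S) : (boundaryCells q S).card ≤ 20 * q := by
  classical
  have hq' : (0 : ℝ) < q := by exact_mod_cast hq
  set signs := ({1, -1} : Finset ℤ) ×ˢ ({1, -1} : Finset ℤ) with hsigns
  set B : ℤ × ℤ → Finset (ℕ × ℕ) := fun s => (boundaryCells q S).filter fun i =>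
    ∃ v ∈ gridCell q i, ∀ w : ℝ × ℝ,
      0 ≤ (s.1 : ℝ) * (w.1 - v.1) → 0 ≤ (s.2 : ℝ) * (w.2 - v.2) → w ∉ S with hB
  have hcover : boundaryCells q S ⊆ signs.biUnion B := by
    intro i hi
    obtain ⟨v, hv, hvS⟩ := not_subset.1 (Finset.mem_filter.1 hi).2.2
    obtain ⟨s, hs, h⟩ := exists_quadrant_disjoint hS hc hvS
    exact Finset.mem_biUnion.2 ⟨s, hs, Finset.mem_filter.2 ⟨hi, v, hv, h⟩⟩
  have hpm : ∀ {s : ℤ}, s ∈ ({1, -1} : Finset ℤ) → s = 1 ∨ s = -1 := by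
    intro s hs
    simpa using hs
  have hside : ∀ {s : ℤ} (_ : s = 1 ∨ s = -1) {k k' : ℕ} {v w : ℝ}, 0 < s * ((k' : ℤ) - k) →
      v ∈ Ioc (((k : ℝ) - 1) / q) (k / q) → w ∈ Ioc (((k' : ℝ) - 1) / q) (k' / q) →
      0 ≤ (s : ℝ) * (w - v) := by
    rintro s (rfl | rfl) k k' v w hk hv hw
    · have h1 : (k : ℝ) ≤ k' - 1 := by
        have : (k : ℤ) ≤ k' - 1 := by omega
        exact_mod_cast this
      have h2 : (k : ℝ) / q ≤ (k' - 1) / q := by gcongr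
      have := hv.2
      have := hw.1
      push_cast
      linarith
    · have h1 : (k' : ℝ) ≤ k - 1 := by
        have : (k' : ℤ) ≤ k - 1 := by omega
        exact_mod_cast this
      have h2 : (k' : ℝ) / q ≤ (k - 1) / q := by gcongr
      have := hv.1
      have := hw.2
      push_cast
      linarith
  -- A cell strictly further out in both directions of s would lie entirely in the quadrant at v,
  -- yet boundary cells meet S.
  have hexcl : ∀ s ∈ signs, ∀ i ∈ B s, ∀ i' ∈ B s, 0 < s.1 * ((i'.1 : ℤ) - i.1) →
      0 < s.2 * ((i'.2 : ℤ) - i.2) → False := by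
    intro s hs i hi i' hi' h1 h2
    have hs' := Finset.mem_product.1 hs
    obtain ⟨-, v, hv, hq⟩ := Finset.mem_filter.1 hi
    obtain ⟨w, hwS, hw⟩ := (Finset.mem_filter.1 (Finset.mem_filter.1 hi').1).2.1
    exact hq w (hside (hpm hs'.1) h1 hv.1 hw.1) (hside (hpm hs'.2) h2 hv.2 hw.2) hwS
  have hBcard : ∀ s ∈ signs, (B s).card ≤ 5 * q := by
    intro s hs
    have hs' := Finset.mem_product.1 hs
    -- The map is constant exactly along the diagonals of direction s; two distinct cells on one
    -- diagonal are strictly ordered in both coordinates, which `hexcl` forbids.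
    have hinj : Set.InjOn (fun i : ℕ × ℕ => s.2 * (i.1 : ℤ) - s.1 * i.2) (B s) := by
      intro i hi i' hi' h
      have e1 := not_and.2 (hexcl s hs i hi i' hi')
      have e2 := not_and.2 (hexcl s hs i' hi' i hi)
      simp only at h
      rcases hpm hs'.1 with h1 | h1 <;> rcases hpm hs'.2 with h2 | h2 <;>
        rw [h1, h2] at h e1 e2 <;> ext <;> by_contra hne <;> omega
    -- This leaves 4q + 1 ≤ 5q diagonals, for each of the four sign patterns.
    have hmaps : ∀ i ∈ B s, s.2 * (i.1 : ℤ) - s.1 * i.2 ∈ Finset.Icc (-(2 * q : ℤ)) (2 * q) := by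
      intro i hi
      have hg := (Finset.mem_filter.1 (Finset.mem_filter.1 hi).1).1
      rw [gridIndex, Finset.mem_product, Finset.mem_Icc, Finset.mem_Icc] at hg
      rw [Finset.mem_Icc]
      rcases hpm hs'.1 with h1 | h1 <;> rcases hpm hs'.2 with h2 | h2 <;> rw [h1, h2] <;>
        constructor <;> omega
    have := Finset.card_le_card_of_injOn _ hmaps hinj
    rw [Int.card_Icc] at this
    omega
  calc (boundaryCells q S).card ≤ (signs.biUnion B).card := Finset.card_le_card hcover
    _ ≤ ∑ s ∈ signs, (B s).card := Finset.card_biUnion_le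
    _ ≤ ∑ s ∈ signs, 5 * q := Finset.sum_le_sum hBcard
    _ = 20 * q := by
      rw [Finset.sum_const, hsigns, Finset.card_product]
      simp
      ring

/-- An additive set function is controlled on the closed convex sets by its values on the cells and
by a bound for its values on subsets of cells. -/
lemma abs_le_sum_gridCell_add {q : ℕ} (hq : 0 < q) {S : Set (ℝ × ℝ)} (hS : IsClosed S)
    (hc : Convex ℝ S) {Λ : Set (ℝ × ℝ) → ℝ} {η : ℝ}
    (hadd : Λ S = ∑ i ∈ gridIndex q, Λ (S ∩ gridCell q i)) (h0 : Λ ∅ = 0)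
    (hη : ∀ i ∈ gridIndex q, |Λ (S ∩ gridCell q i)| ≤ η) (hη0 : 0 ≤ η) :
    |Λ S| ≤ ∑ i ∈ gridIndex q, |Λ (gridCell q i)| + 20 * q * η := by
  classical
  have hterm : ∀ i ∈ gridIndex q, |Λ (S ∩ gridCell q i)| ≤
      |Λ (gridCell q i)| + if i ∈ boundaryCells q S then η else 0 := by
    intro i hi
    split_ifs with hb
    · linarith [hη i hi, abs_nonneg (Λ (gridCell q i))]
    · rw [add_zero]
      by_cases hne : (S ∩ gridCell q i).Nonempty
      · have hsub : gridCell q i ⊆ S := by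
          by_contra hn
          exact hb (Finset.mem_filter.2 ⟨hi, hne, hn⟩)
        rw [inter_eq_right.2 hsub]
      · rw [not_nonempty_iff_eq_empty.1 hne, h0, abs_zero]
        exact abs_nonneg _
  have hsub : boundaryCells q S ⊆ gridIndex q := Finset.filter_subset _ _
  rw [hadd]
  calc _ ≤ ∑ i ∈ gridIndex q, |Λ (S ∩ gridCell q i)| := Finset.abs_sum_le_sum_abs _ _
    _ ≤ ∑ i ∈ gridIndex q, (|Λ (gridCell q i)| + if i ∈ boundaryCells q S then η else 0) :=
        Finset.sum_le_sum hterm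
    _ = ∑ i ∈ gridIndex q, |Λ (gridCell q i)| + (boundaryCells q S).card * η := by
        rw [Finset.sum_add_distrib, ← Finset.sum_filter, Finset.filter_mem_eq_inter,
          Finset.inter_eq_right.2 hsub, Finset.sum_const, nsmul_eq_mul]
    _ ≤ _ := by
        gcongr
        exact_mod_cast card_boundaryCells_le hq hS hc

/-! ### The two criteria as set functions -/

lemma unitSquare_ae_eq_halfOpenSquare : unitSquare =ᵐ[volume] halfOpenSquare := by
  rw [unitSquare, halfOpenSquare, Measure.volume_eq_prod]
  exact Measure.set_prod_ae_eq Ioc_ae_eq_Icc.symm Ioc_ae_eq_Icc.symm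

lemma volume_unitSquare_ne_top : volume unitSquare ≠ ⊤ := by
  rw [measure_congr unitSquare_ae_eq_halfOpenSquare]
  simpa using measure_ne_top (volume.restrict halfOpenSquare) univ

lemma limitCriterion_empty (γ : ℝ) (S₀ : Set (ℝ × ℝ)) : limitCriterion γ S₀ ∅ = 0 := by
  simp [limitCriterion]

lemma empiricalCriterion_empty (K₀ : ℝ → ℝ) (L₀ h γ : ℝ) (m : ℕ) (y : ℕ × ℕ → ℝ) :
    empiricalCriterion K₀ L₀ h γ m y ∅ = 0 := by
  simp [empiricalCriterion]

/-- The cells miss only the left and lower edges of the square, a null set. -/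
lemma volume_real_inter_eq_sum_gridCell {q : ℕ} (hq : 0 < q) {T S : Set (ℝ × ℝ)}
    (hT : MeasurableSet T) (hS : MeasurableSet S) (hSU : S ⊆ unitSquare) :
    volume.real (T ∩ S) = ∑ i ∈ gridIndex q, volume.real (T ∩ (S ∩ gridCell q i)) := by
  have h1 : (T ∩ S : Set (ℝ × ℝ)) =ᵐ[volume] ⋃ i ∈ gridIndex q, T ∩ (S ∩ gridCell q i) := by
    have e : ⋃ i ∈ gridIndex q, T ∩ (S ∩ gridCell q i) = (T ∩ S) ∩ halfOpenSquare := by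
      ext x
      simp only [mem_iUnion, exists_prop, mem_inter_iff]
      constructor
      · rintro ⟨i, hi, hT, hS, hx⟩
        exact ⟨⟨hT, hS⟩, gridCell_subset_halfOpenSquare hq hi hx⟩
      · rintro ⟨⟨hT, hS⟩, hx⟩
        have hi := cellIndex_mem_gridIndex hq hx
        exact ⟨_, hi, hT, hS, (mem_gridCell_iff hq hi).2 ⟨hx, rfl⟩⟩
    rw [e]
    have := (ae_eq_refl (T ∩ S : Set (ℝ × ℝ))).inter unitSquare_ae_eq_halfOpenSquare
    rwa [inter_eq_left.2 (inter_subset_right.trans hSU)] at this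
  rw [measureReal_congr h1, measureReal_biUnion_finset ?_ ?_ ?_]
  · intro i hi j hj hij
    exact (pairwiseDisjoint_gridCell hq hi hj hij).mono
      (inter_subset_right.trans inter_subset_right) (inter_subset_right.trans inter_subset_right)
  · exact fun i _ => hT.inter (hS.inter (measurableSet_gridCell q i))
  · exact fun i _ => ne_top_of_le_ne_top volume_unitSquare_ne_top
      (measure_mono (inter_subset_right.trans (inter_subset_left.trans hSU)))

lemma limitCriterion_eq_sum_gridCell (γ : ℝ) {q : ℕ} (hq : 0 < q) {S₀ S : Set (ℝ × ℝ)}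
    (hS₀ : MeasurableSet S₀) (hS : MeasurableSet S) (hSU : S ⊆ unitSquare) :
    limitCriterion γ S₀ S = ∑ i ∈ gridIndex q, limitCriterion γ S₀ (S ∩ gridCell q i) := by
  simp only [limitCriterion]
  rw [Finset.sum_add_distrib, ← Finset.mul_sum, ← Finset.mul_sum,
    volume_real_inter_eq_sum_gridCell hq hS₀ hS hSU,
    volume_real_inter_eq_sum_gridCell hq hS₀.compl hS hSU]

/-- Exact for every S: design points have positive coordinates, so each lies in exactly one cell. -/
lemma empiricalCriterion_eq_sum_gridCell (K₀ : ℝ → ℝ) (L₀ h γ : ℝ) (m : ℕ) (y : ℕ × ℕ → ℝ) {q : ℕ}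
    (hq : 0 < q) (S : Set (ℝ × ℝ)) :
    empiricalCriterion K₀ L₀ h γ m y S =
      ∑ i ∈ gridIndex q, empiricalCriterion K₀ L₀ h γ m y (S ∩ gridCell q i) := by
  classical
  simp only [empiricalCriterion]
  rw [← Finset.mul_sum, Finset.sum_comm]
  congr 1
  refine Finset.sum_congr rfl fun k hk => ?_
  rw [← Finset.mul_sum]
  congr 1
  have hx := designPoint_mem_halfOpenSquare (Finset.mem_filter.1 hk).1
  have hi := cellIndex_mem_gridIndex hq hx
  rw [Finset.sum_eq_single_of_mem _ hi]
  · have hxc := (mem_gridCell_iff hq hi).2 ⟨hx, rfl⟩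
    simp only [indicator_apply, mem_inter_iff, hxc, and_true]
  · intro j hj hne
    refine indicator_of_notMem (fun hmem => hne ?_) _
    exact ((mem_gridCell_iff hq hj).1 hmem.2).2.symm

lemma abs_limitCriterion_inter_gridCell_le {γ : ℝ} (hγ : γ ∈ Icc (0 : ℝ) 1) (S₀ S : Set (ℝ × ℝ))
    {q : ℕ} (hq : 0 < q) {i : ℕ × ℕ} (hi : i ∈ gridIndex q) :
    |limitCriterion γ S₀ (S ∩ gridCell q i)| ≤ 2 / (q : ℝ) ^ 2 := by
  have hfin : volume (gridCell q i) ≠ ⊤ := ne_top_of_le_ne_top volume_unitSquare_ne_top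
    (measure_mono ((gridCell_subset_halfOpenSquare hq hi).trans halfOpenSquare_subset_unitSquare))
  have key : ∀ T : Set (ℝ × ℝ), volume.real (T ∩ (S ∩ gridCell q i)) ≤ 1 / (q : ℝ) ^ 2 := by
    intro T
    rw [← volume_real_gridCell q i]
    exact measureReal_mono (inter_subset_right.trans inter_subset_right) hfin
  have a1 : |1 / 2 - γ| ≤ 1 := by rw [abs_le]; constructor <;> linarith [hγ.1, hγ.2]
  have a2 : |1 - γ| ≤ 1 := by rw [abs_le]; constructor <;> linarith [hγ.1, hγ.2]
  rw [limitCriterion]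
  calc _ ≤ _ := abs_add_le _ _
    _ = |1 / 2 - γ| * volume.real (S₀ ∩ (S ∩ gridCell q i)) +
        |1 - γ| * volume.real (S₀ᶜ ∩ (S ∩ gridCell q i)) := by
      rw [abs_mul, abs_mul, abs_of_nonneg measureReal_nonneg, abs_of_nonneg measureReal_nonneg]
    _ ≤ 1 * (1 / (q : ℝ) ^ 2) + 1 * (1 / (q : ℝ) ^ 2) := by
      gcongr
      · exact key _
      · exact key _
    _ = 2 / (q : ℝ) ^ 2 := by ring

/-- A cell lies in a ball of radius 1/q, which has at most (2m/q + 1)² ≤ (3m/q)² design points when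
q ≤ m. -/
lemma abs_empiricalCriterion_le_of_subset_gridCell (K₀ : ℝ → ℝ) (L₀ h : ℝ) {γ : ℝ}
    (hγ : γ ∈ Icc (0 : ℝ) 1) {m : ℕ} (y : ℕ × ℕ → ℝ) {q : ℕ} (hq : 0 < q)
    (hqm : q ≤ m) {i : ℕ × ℕ} {T : Set (ℝ × ℝ)} (hT : T ⊆ gridCell q i) :
    |empiricalCriterion K₀ L₀ h γ m y T| ≤ 9 / (q : ℝ) ^ 2 := by
  classical
  have hq' : (0 : ℝ) < q := by exact_mod_cast hq
  have hqm' : (q : ℝ) ≤ m := by exact_mod_cast hqm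
  have hm' : (0 : ℝ) < m := hq'.trans_le hqm'
  rw [empiricalCriterion_eq_sum, abs_mul, abs_of_nonneg (by positivity)]
  set G := (gridIndex m).filter fun k => designPoint m k ∈ innerSquare L₀ h ∩ T
  have hG : (G.card : ℝ) ≤ (2 * (1 / q) * m + 1) ^ 2 := by
    refine le_trans ?_ (card_filter_designPoint_mem_closedBall_le m (designPoint q i)
      (by positivity))
    refine Nat.cast_le.2 (Finset.card_le_card (Finset.monotone_filter_right _ fun k _ hk => ?_))
    exact gridCell_subset_closedBall i (hT hk.2)
  have hsum : |∑ k ∈ G, (normalScore K₀ h m y k - γ)| ≤ G.card := by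
    refine (Finset.abs_sum_le_sum_abs _ _).trans ?_
    rw [← nsmul_one, ← Finset.sum_const]
    refine Finset.sum_le_sum fun k _ => ?_
    have h1 := normalScore_nonneg K₀ h m y k
    have h2 := normalScore_le_one K₀ h m y k
    rw [abs_le]
    constructor <;> linarith [hγ.1, hγ.2]
  have h3 : 2 * (1 / (q : ℝ)) * m + 1 ≤ 3 * (m / q) := by
    have : (1 : ℝ) ≤ m / q := (one_le_div hq').2 hqm'
    have e : 2 * (1 / (q : ℝ)) * m = 2 * (m / q) := by ring
    linarith
  calc _ ≤ 1 / (m : ℝ) ^ 2 * (3 * (m / q)) ^ 2 := by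
        gcongr
        exact hsum.trans (hG.trans (pow_le_pow_left₀ (by positivity) h3 2))
    _ = 9 / (q : ℝ) ^ 2 := by
        field_simp
        norm_num

/-! ### Minimizers, separation and uniform convergence -/

lemma exists_isMinimizer_empiricalCriterion (K₀ : ℝ → ℝ) (L₀ h γ : ℝ) (m : ℕ) (y : ℕ × ℕ → ℝ) :
    ∃ S, IsMinimizer (empiricalCriterion K₀ L₀ h γ m y) S := by
  classical
  -- The criterion sees S only through the finite set of design points that S captures, so it takes
  -- finitely many values.
  have hfin : (empiricalCriterion K₀ L₀ h γ m y '' closedConvexSets).Finite := by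
    refine Set.Finite.subset (((gridIndex m).powerset.image fun G =>
      1 / (m : ℝ) ^ 2 * ∑ i ∈ G, (normalScore K₀ h m y i - γ)).finite_toSet) ?_
    rintro _ ⟨S, -, rfl⟩
    rw [Finset.mem_coe, Finset.mem_image]
    refine ⟨(gridIndex m).filter fun i => designPoint m i ∈ innerSquare L₀ h ∩ S,
      Finset.mem_powerset.2 (Finset.filter_subset _ _), ?_⟩
    rw [empiricalCriterion_eq_sum]
  have hne : (∅ : Set (ℝ × ℝ)) ∈ closedConvexSets :=
    ⟨empty_subset _, isClosed_empty, convex_empty⟩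
  obtain ⟨_, ⟨S, hS, rfl⟩, hmin⟩ := Set.exists_min_image _ id hfin ⟨_, mem_image_of_mem _ hne⟩
  exact ⟨S, hS, fun T hT => hmin _ (mem_image_of_mem _ hT)⟩

/-- The limiting criterion separates `S₀` from the other closed convex sets. -/
lemma mul_volume_symmDiff_le_limitCriterion_sub (γ : ℝ) {S₀ S : Set (ℝ × ℝ)}
    (hS₀ : S₀ ∈ closedConvexSets) (hS : S ∈ closedConvexSets) :
    min (γ - 1 / 2) (1 - γ) * volume.real (S ∆ S₀) ≤
      limitCriterion γ S₀ S - limitCriterion γ S₀ S₀ := by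
  have hfin : ∀ {T : Set (ℝ × ℝ)}, T ∈ closedConvexSets → volume T ≠ ⊤ := fun hT =>
    ne_top_of_le_ne_top volume_unitSquare_ne_top (measure_mono hT.1)
  -- Splitting λ(S₀) along S turns the difference of criteria into (γ - 1/2) λ(S₀ \ S) + (1 - γ) λ(S
  -- \ S₀).
  have e1 := measureReal_sdiff_add_inter (μ := volume) (s := S₀) hS.2.1.measurableSet (hfin hS₀)
  rw [measureReal_symmDiff_eq hS.2.1.measurableSet hS₀.2.1.measurableSet (hfin hS) (hfin hS₀)]
  have e2 : S₀ᶜ ∩ S = S \ S₀ := by rw [inter_comm, sdiff_eq]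
  rw [limitCriterion, limitCriterion, inter_self, compl_inter_self, e2, measureReal_empty, ← e1]
  have h1 := mul_le_mul_of_nonneg_right (min_le_left (γ - 1 / 2) (1 - γ))
    (measureReal_nonneg (μ := volume) (s := S₀ \ S))
  have h2 := mul_le_mul_of_nonneg_right (min_le_right (γ - 1 / 2) (1 - γ))
    (measureReal_nonneg (μ := volume) (s := S \ S₀))
  linarith

/-- Uniform convergence in probability of the empirical criterion over the closed convex sets. -/
lemma tendsto_measure_exists_abs_empiricalCriterion_sub {Ω : Type*} [MeasurableSpace Ω]
    {P : Measure Ω} [IsProbabilityMeasure P] {μ : ℝ × ℝ → ℝ} {K₀ : ℝ → ℝ} {L₀ : ℝ}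
    {h : ℕ → ℝ} {ν : Measure ℝ} {ε : ℕ → ℕ × ℕ → Ω → ℝ} {γ : ℝ}
    (hμ : ContinuousOn μ unitSquare) (hμ0 : ∀ x ∈ unitSquare, 0 ≤ μ x)
    (hK : IsSmoothingKernel K₀ L₀)
    (hh : Tendsto h atTop (𝓝 0)) (hmh : Tendsto (fun m : ℕ => m * h m) atTop atTop)
    (hν : MemLp (fun t : ℝ => t) 2 ν) (hν0 : ∫ t, t ∂ν = 0)
    (hlaw : ∀ m, ∀ i ∈ gridIndex m, HasLaw (ε m i) ν P)
    (hind : ∀ m, iIndepFun (fun i : gridIndex m => ε m i) P) (hγ : γ ∈ Icc (0 : ℝ) 1)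
    (hS₀ : Convex ℝ (baselineSet μ)) (hS₀m : MeasurableSet (baselineSet μ)) {δ : ℝ} (hδ : 0 < δ) :
    Tendsto (fun m => P {ω | ∃ S ∈ closedConvexSets, δ ≤ |empiricalCriterion K₀ L₀ (h m) γ m
      (response μ m fun i => ε m i ω) S - limitCriterion γ (baselineSet μ) S|})
      atTop (𝓝 0) := by
  -- The constant is 20 · (9 + 2): at most 20q boundary cells, each costing 9/q² for the empirical
  -- and 2/q² for the limiting criterion. Hence they cost 220/q < δ/2.
  obtain ⟨q, hqδ⟩ := exists_nat_gt (220 / (δ / 2))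
  have hq' : (0 : ℝ) < q := lt_of_le_of_lt (by positivity) hqδ
  have hq : 0 < q := by exact_mod_cast hq'
  rw [div_lt_iff₀ (half_pos hδ)] at hqδ
  set D : ℕ → Ω → Set (ℝ × ℝ) → ℝ := fun m ω S => empiricalCriterion K₀ L₀ (h m) γ m
      (response μ m fun i => ε m i ω) S - limitCriterion γ (baselineSet μ) S with hD
  have hbound : ∀ m, q ≤ m → ∀ ω, ∀ S ∈ closedConvexSets,
      |D m ω S| ≤ ∑ i ∈ gridIndex q, |D m ω (gridCell q i)| + 220 / q := by
    intro m hqm ω S hS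
    have := abs_le_sum_gridCell_add hq hS.2.1 hS.2.2 (Λ := D m ω) (η := 11 / (q : ℝ) ^ 2)
      (by
        simp only [hD]
        rw [Finset.sum_sub_distrib, ← empiricalCriterion_eq_sum_gridCell _ _ _ _ _ _ hq,
          ← limitCriterion_eq_sum_gridCell _ hq hS₀m hS.2.1.measurableSet hS.1])
      (by simp only [hD, empiricalCriterion_empty, limitCriterion_empty, sub_zero])
      (fun i hi => by
        have h1 := abs_limitCriterion_inter_gridCell_le hγ (baselineSet μ) S hq hi
        have h2 := abs_empiricalCriterion_le_of_subset_gridCell K₀ L₀ (h m) hγ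
          (response μ m fun i => ε m i ω) hq hqm (inter_subset_right (s := S) (t := gridCell q i))
        have h3 : (11 : ℝ) / (q : ℝ) ^ 2 = 9 / (q : ℝ) ^ 2 + 2 / (q : ℝ) ^ 2 := by ring
        rw [h3]
        rw [abs_le] at h1 h2 ⊢
        simp only [hD]
        constructor <;> linarith [h1.1, h1.2, h2.1, h2.2])
      (by positivity)
    refine this.trans (le_of_eq ?_)
    congr 1
    field_simp
    norm_num
  have hcard : 0 < ((gridIndex q).card : ℝ) := by
    rw [card_gridIndex]
    positivity
  -- The other δ/2 is shared equally among the q² cells, which stay fixed as m grows.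
  set δ' := δ / 2 / (gridIndex q).card with hδ'
  have hδ'0 : 0 < δ' := by positivity
  have hlim : Tendsto (fun m => ∑ i ∈ gridIndex q, P {ω | δ' ≤ |D m ω (gridCell q i)|})
      atTop (𝓝 0) := by
    have := tendsto_finsetSum (gridIndex q) fun i hi =>
      tendsto_measure_abs_empiricalCriterion_sub hμ hμ0 hK hh hmh hν hν0 hlaw hind hγ hS₀ hS₀m
        (convex_gridCell q i) (measurableSet_gridCell q i) (gridCell_subset_halfOpenSquare hq hi)
        hδ'0
    simpa using this
  refine tendsto_of_tendsto_of_tendsto_of_le_of_le' tendsto_const_nhds hlim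
    (Eventually.of_forall fun _ => zero_le) ?_
  filter_upwards [eventually_ge_atTop q] with m hqm
  refine (measure_mono ?_).trans (measure_biUnion_finset_le (gridIndex q)
    fun i => {ω | δ' ≤ |D m ω (gridCell q i)|})
  rintro ω ⟨S, hS, hSδ⟩
  by_contra hn
  simp only [mem_iUnion, exists_prop, not_exists, not_and] at hn
  have hlt : ∑ i ∈ gridIndex q, |D m ω (gridCell q i)| ≤ δ / 2 := by
    calc _ ≤ ∑ i ∈ gridIndex q, δ' := Finset.sum_le_sum fun i hi => (not_le.1 (hn i hi)).le
      _ = δ / 2 := by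
        rw [Finset.sum_const, nsmul_eq_mul, hδ']
        field_simp
  have h220 : 220 / (q : ℝ) < δ / 2 := by
    rw [div_lt_iff₀ hq']
    linarith
  have := hbound m hqm ω S hS
  have hSδ' : δ ≤ |D m ω S| := hSδ
  linarith

end BaselineRegion

/-! ### Consistency of the minimizers -/

theorem mainTheorem5
    {Ω : Type*} [MeasurableSpace Ω] (P : Measure Ω) [IsProbabilityMeasure P]
    -- the regression function, with baseline value `0`
    (μ : ℝ × ℝ → ℝ)
    (hμ_cont : ContinuousOn μ BaselineRegion.unitSquare)
    (hμ_nonneg : ∀ x ∈ BaselineRegion.unitSquare, 0 ≤ μ x)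
    -- the kernel and the bandwidth
    (K₀ : ℝ → ℝ) (L₀ : ℝ) (hK : BaselineRegion.IsSmoothingKernel K₀ L₀)
    (h₀ β : ℝ) (hh₀ : 0 < h₀) (hβ_pos : 0 < β) (hβ_lt : β < 1 / 2)
    -- the errors: for each `m`, an i.i.d. array with a fixed centered law of finite variance
    (ν : Measure ℝ) [IsProbabilityMeasure ν] (hν_sq : MemLp (fun t : ℝ => t) 2 ν)
    (hν_mean : ∫ t, t ∂ν = 0)
    (ε : ℕ → ℕ × ℕ → Ω → ℝ)
    (hε_law : ∀ m, ∀ i ∈ BaselineRegion.gridIndex m, HasLaw (ε m i) ν P)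
    (hε_indep : ∀ m, iIndepFun (fun i : BaselineRegion.gridIndex m => ε m i) P)
    -- the level, and the baseline region as unique minimizer of the limiting criterion
    (γ : ℝ) (hγ : γ ∈ Ioo (1 / 2 : ℝ) 1)
    (S₀ : Set (ℝ × ℝ)) (hS₀ : S₀ = BaselineRegion.baselineSet μ)
    (hS₀_min : BaselineRegion.IsMinimizer (BaselineRegion.limitCriterion γ S₀) S₀)
    (hS₀_unique : ∀ S, BaselineRegion.IsMinimizer (BaselineRegion.limitCriterion γ S₀) S → S = S₀)
    -- the empirical criterion
    (M : ℕ → Ω → Set (ℝ × ℝ) → ℝ)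
    (hM : ∀ m ω, M m ω =
      BaselineRegion.empiricalCriterion K₀ L₀ (BaselineRegion.bandwidth h₀ β m) γ m
        (BaselineRegion.response μ m (fun i => ε m i ω))) :
    TendstoInMeasure P
        (fun m ω => ⨆ S : BaselineRegion.closedConvexSets,
          |M m ω S - BaselineRegion.limitCriterion γ S₀ S|)
        atTop (fun _ => (0 : ℝ)) ∧
      (∀ m ω, ∃ S, BaselineRegion.IsMinimizer (M m ω) S) ∧
      ∀ Shat : ℕ → Ω → Set (ℝ × ℝ),
        (∀ m ω, BaselineRegion.IsMinimizer (M m ω) (Shat m ω)) →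
        TendstoInMeasure P (fun m ω => volume.real (Shat m ω ∆ S₀)) atTop (fun _ => (0 : ℝ)) := by
  subst hS₀
  have hγ' : γ ∈ Icc (0 : ℝ) 1 := ⟨by linarith [hγ.1], hγ.2.le⟩
  have hS₀c := hS₀_min.1
  have hunif : ∀ δ > 0, Tendsto (fun m => P {ω | ∃ S ∈ BaselineRegion.closedConvexSets,
      δ ≤ |M m ω S - BaselineRegion.limitCriterion γ (BaselineRegion.baselineSet μ) S|})
      atTop (𝓝 0) := by
    intro δ hδ
    simp only [hM]
    exact BaselineRegion.tendsto_measure_exists_abs_empiricalCriterion_sub hμ_cont hμ_nonneg hK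
      (BaselineRegion.tendsto_bandwidth h₀ hβ_pos) (BaselineRegion.tendsto_mul_bandwidth hh₀ hβ_lt)
      hν_sq hν_mean hε_law hε_indep hγ' hS₀c.2.2 hS₀c.2.1.measurableSet hδ
  refine ⟨?_, fun m ω => ?_, fun Shat hShat => ?_⟩
  · rw [tendstoInMeasure_iff_dist]
    intro δ hδ
    -- Passing to the supremum turns the strict bound into a weak one, so δ/2 is used in place of δ.
    -- Monotonicity of the outer measure requires no measurability of the events.
    refine tendsto_of_tendsto_of_tendsto_of_le_of_le tendsto_const_nhds
      (hunif (δ / 2) (half_pos hδ))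
      (fun _ => zero_le) fun m => measure_mono fun ω hω => ?_
    by_contra hn
    have hn' : ∀ S ∈ BaselineRegion.closedConvexSets, |M m ω S -
        BaselineRegion.limitCriterion γ (BaselineRegion.baselineSet μ) S| < δ / 2 := by
      intro S hS
      by_contra hle
      exact hn ⟨S, hS, not_lt.1 hle⟩
    have hsup : (⨆ S : BaselineRegion.closedConvexSets, |M m ω S -
        BaselineRegion.limitCriterion γ (BaselineRegion.baselineSet μ) S|) ≤ δ / 2 :=
      Real.iSup_le (fun S => (hn' S S.2).le) (half_pos hδ).le
    have hnonneg : 0 ≤ ⨆ S : BaselineRegion.closedConvexSets, |M m ω S -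
        BaselineRegion.limitCriterion γ (BaselineRegion.baselineSet μ) S| :=
      Real.iSup_nonneg fun S => abs_nonneg _
    have hω' : δ ≤ dist (⨆ S : BaselineRegion.closedConvexSets, |M m ω S -
        BaselineRegion.limitCriterion γ (BaselineRegion.baselineSet μ) S|) 0 := hω
    rw [Real.dist_eq, sub_zero, abs_of_nonneg hnonneg] at hω'
    linarith
  · rw [hM]
    exact BaselineRegion.exists_isMinimizer_empiricalCriterion _ _ _ _ _ _
  · rw [tendstoInMeasure_iff_dist]
    intro δ hδ
    have hc : 0 < min (γ - 1 / 2) (1 - γ) :=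
      lt_min (by linarith [hγ.1]) (by linarith [hγ.2])
    -- Otherwise both criteria differ by less than cδ/2 at Ŝ and at S₀, with c the minimum. As Ŝ is
    -- a minimizer, M(Ŝ) - M(S₀) < cδ, against separation.
    refine tendsto_of_tendsto_of_tendsto_of_le_of_le tendsto_const_nhds
      (hunif (min (γ - 1 / 2) (1 - γ) * δ / 2) (by positivity))
      (fun _ => zero_le) fun m => measure_mono fun ω hω => ?_
    have hω' : δ ≤ dist (volume.real (Shat m ω ∆ BaselineRegion.baselineSet μ)) 0 := hω
    rw [Real.dist_eq, sub_zero, abs_of_nonneg measureReal_nonneg] at hω'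
    by_contra hn
    have hn' : ∀ S ∈ BaselineRegion.closedConvexSets, |M m ω S -
        BaselineRegion.limitCriterion γ (BaselineRegion.baselineSet μ) S| <
        min (γ - 1 / 2) (1 - γ) * δ / 2 := by
      intro S hS
      by_contra hle
      exact hn ⟨S, hS, not_lt.1 hle⟩
    have h1 := abs_lt.1 (hn' _ (hShat m ω).1)
    have h2 := abs_lt.1 (hn' _ hS₀c)
    have h3 := (hShat m ω).2 _ hS₀c
    have h4 := BaselineRegion.mul_volume_symmDiff_le_limitCriterion_sub γ hS₀c (hShat m ω).1
    have h5 := mul_le_mul_of_nonneg_left hω' hc.le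
    linarith [h1.1, h2.2]
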